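/- Throughout, an H-matrix of size $M$ is a lower triangular real $M\times M$ matrix $H=(h_{k,j})$ with indices $1,\dots,M$; its H-dual is $H^{\mathsf A}=(h_{M+1-j,\,M+1-k})_{k,j}$, and for $m\ge1$ \[ Q(m,j;H)=\sum_{j=j(1)\le i(1)<j(2)\le i(2)<\cdots<j(m)\le i(m)\le M}\ \prod_{r=1}^m h_{i(r),j(r)} . \] For $H_1$ of size $N'-1$ and $H_2$ of size $N-N'-1$ ($1\le N'\le N-1$), the gluing $H_1\bowtie H_2$ is the matrix $H=(h_{k,j})$ of size $N-1$ whose leading block (indices $<N'$) is $H_1$, whose trailing block (indices $>N'$) is $H_2$, whose $N'$-th row is $h_{N',j}=-\frac{N-N'}{N}\sum_{k=j}^{N'-1}(H_1)_{k,j}$ for $j<N'$ and $h_{N',N'}=\frac{N'(N-N')}{N}$, whose entries $h_{N'+1,N'},\dots,h_{N-1,N'}$ are determined by $Q(k,N';H)=\frac{N'(N-N'+1)}{N(k+1)}\binom{N-N'-1}{k-1}$ for $k=1,\dots,N-N'$, and whose remaining entries are $0$. Let $H^{(0)}=[\,\,]$ be the empty matrix and $H^{(n+1)}=H^{(n)}\bowtie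 (H^{(n)})^{\mathsf A}$, a matrix of size $2^{n+1}-1$. Let $X$ be a real Hilbert space and $T:X\to X$ an operator (in particular, any nonexpansive one). The Fractal Self-Dual Method (FSDM) generates from $y_0\in X$ the sequence $(y_k)$ such that, for every $n\ge1$ and $0\le k<2^n-1$, \[ y_{k+1}=y_k-\sum_{j=0}^{k}h^{(n)}_{k+1,j+1}\,(y_j-Ty_j). \] Put $g_t=\frac12(y_{t-1}-Ty_{t-1})$ for $t\ge1$. For $j\ge1$ let $\nu_2(j)$ be the $2$-adic valuation of $j$ and $m(j)=j-2^{\nu_2(j)}$. **Proposition.** 1. (Well-definedness.) For every $n\ge 0$ the equations defining the new column in $H^{(n)}\bowtie(H^{(n)})^{\mathsf A}$ have exactly one solution, and for every $T$ and $y_0$ there is exactly one FSDM sequence starting at $y_0$. 2. (Fractal structure.) For $n\ge1$, \[ H^{(n)}=\begin{bmatrix} H^{(n-1)} & & \\ -\frac12 a^{(n-1)} & 2^{n-2} & \\ 0 & -\frac12 b^{(n-1)} & H^{(n-1)}\end{bmatrix}, \] where $a^{(0)}$ is empty, $a^{(n)}=\big[\frac12a^{(n-1)},\ \frac{2^{n-1}+1}{4},\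 a^{(n-1)}\big]\in\mathbb R^{2^n-1}$ for $n\ge1$ (so $a^{(1)}=[\frac12]$), and $b^{(n)}$ is the column vector with the entries of $a^{(n)}$ in reversed order. In particular $h^{(n)}_{i,i}=2^{\nu_2(i)-1}$ for $1\le i\le 2^n-1$. 3. (Recurrence.) For every $j\ge1$, if $m(j)=2^{i_1}+\dots+2^{i_p}$ with $i_1>\dots>i_p$ ($p\ge0$) and $t_r=\sum_{q=1}^r2^{i_q}$, then the FSDM iterates satisfy \[ y_j=y_{j-1}-2^{\nu_2(j)}g_j+\tfrac12\big(y_{m(j)}-y_{j-1}\big)+\sum_{r=1}^p2^{\nu_2(j)-r}g_{t_{p-r+1}} . \] In particular, $y_{2^n}=y_{2^n-1}-2^ng_{2^n}+\frac12(y_0-y_{2^n-1})$ for all $n\ge 0$. 4. (Memory.) FSDM needs memory for only $O(\log N)$ vectors of $X$ to run $N$ iterations. Precisely: consider a machine whose registers each hold one vector of $X$ and whose instructions are $R_a:=TR_b$ and $R_a:=\alpha R_b+\beta R_c$ with $\alpha,\beta\in\mathbb R$. There are a constant $C$ and finite instruction lists $P_1,P_2,\dots$, none of them depending on $X$, $T$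 or $y_0$, such that each $P_j$ evaluates $T$ exactly once; such that $P_1,\dots,P_N$ together use only registers with index smaller than $2\lfloor\log_2N\rfloor+C$, for every $N\ge1$; and such that, when the registers initially hold arbitrary vectors except that $R_0=y_0$, register $R_0$ holds $y_j$ after $P_1,\dots,P_j$ have been run, for every $j\ge0$. -/

import Mathlib

universe u

/-! ### H-matrices

A step-size matrix of an `M`-step method is a Mathlib matrix indexed by `Fin M`.
Its entries are always addressed with indices `1, …, M`, through `HMat.entry`. -/

/-- The entry `h_{k,j}` (indices from `1` to `M`); zero for indices outside this range. -/
def HMat.entry {M : ℕ} (H : Matrix (Fin M) (Fin M) ℝ) (k j : ℕ) : ℝ :=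
  if h : (1 ≤ k ∧ k ≤ M) ∧ (1 ≤ j ∧ j ≤ M) then
    H ⟨k - 1, by omega⟩ ⟨j - 1, by omega⟩
  else 0

/-- The `M × M` matrix with entries `f k j`, `1 ≤ k, j ≤ M`. -/
def HMat.ofEntries (M : ℕ) (f : ℕ → ℕ → ℝ) : Matrix (Fin M) (Fin M) ℝ :=
  Matrix.of fun k j => f (k.1 + 1) (j.1 + 1)

/-- The H-dual, i.e. the reflection along the anti-diagonal:
`(Hᴬ)_{k,j} = h_{N-j,N-k}` with `N = M + 1`. -/
def HMat.dual {M : ℕ} (H : Matrix (Fin M) (Fin M) ℝ) : Matrix (Fin M) (Fin M) ℝ :=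
  HMat.ofEntries M fun k j => HMat.entry H (M + 1 - j) (M + 1 - k)

/-- The Q-function `Q(m, j; H)`: the sum of `∏_{r=1}^m h_{i(r),j(r)}` over all chains
`j = j(1) ≤ i(1) < j(2) ≤ i(2) < ⋯ < j(m) ≤ i(m) ≤ M`, computed by splitting off the
first factor `h_{i(1),j}` and summing over `l = j(2)`. Only `m ≥ 1` is meaningful. -/
noncomputable def HMat.Q {M : ℕ} (H : Matrix (Fin M) (Fin M) ℝ) : ℕ → ℕ → ℝ
  | 0, _ => 0
  | 1, j => ∑ i ∈ Finset.Icc j M, HMat.entry H i j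
  | m + 2, j => ∑ i ∈ Finset.Icc j M,
      HMat.entry H i j * ∑ l ∈ Finset.Icc (i + 1) M, HMat.Q H (m + 1) l

/-! ### Gluing

`H₁` has size `M₁ = N' - 1` and `H₂` has size `M₂ = N - N' - 1`, so `N' = M₁ + 1`,
`N - N' = M₂ + 1`, `N = M₁ + M₂ + 2`, and the glued matrix has size
`N - 1 = M₁ + 1 + M₂`. -/

/-- The glued matrix in which the entries `h_{N'+1,N'}, …, h_{N-1,N'}` below the new
diagonal entry are given by the column `c`. -/
noncomputable def HMat.glueWith {M₁ M₂ : ℕ} (H₁ : Matrix (Fin M₁) (Fin M₁) ℝ)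
    (H₂ : Matrix (Fin M₂) (Fin M₂) ℝ) (c : Fin M₂ → ℝ) :
    Matrix (Fin (M₁ + 1 + M₂)) (Fin (M₁ + 1 + M₂)) ℝ :=
  HMat.ofEntries (M₁ + 1 + M₂) fun k j =>
    if k < M₁ + 1 then
      HMat.entry H₁ k j
    else if k = M₁ + 1 then
      if j < M₁ + 1 then
        -(((M₂ : ℝ) + 1) / ((M₁ : ℝ) + M₂ + 2)) * ∑ i ∈ Finset.Icc j M₁, HMat.entry H₁ i j
      else if j = M₁ + 1 then
        ((M₁ : ℝ) + 1) * ((M₂ : ℝ) + 1) / ((M₁ : ℝ) + M₂ + 2)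
      else 0
    else
      if j < M₁ + 1 then 0
      else if j = M₁ + 1 then
        if h : k - (M₁ + 2) < M₂ then c ⟨k - (M₁ + 2), h⟩ else 0
      else HMat.entry H₂ (k - (M₁ + 1)) (j - (M₁ + 1))

/-- The condition that determines the new column:
`Q(k, N'; H) = N' (N - N' + 1) / (N (k + 1)) * binom (N - N' - 1) (k - 1)` for
`k = 1, …, N - N'`. -/
def HMat.IsGluingColumn {M₁ M₂ : ℕ} (H₁ : Matrix (Fin M₁) (Fin M₁) ℝ)
    (H₂ : Matrix (Fin M₂) (Fin M₂) ℝ) (c : Fin M₂ → ℝ) : Prop :=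
  ∀ k : ℕ, 1 ≤ k → k ≤ M₂ + 1 →
    HMat.Q (HMat.glueWith H₁ H₂ c) k (M₁ + 1) =
      ((M₁ : ℝ) + 1) * ((M₂ : ℝ) + 2) / (((M₁ : ℝ) + M₂ + 2) * ((k : ℝ) + 1)) *
        (Nat.choose M₂ (k - 1) : ℝ)

open Classical in
/-- The gluing `H₁ ⋈ H₂`: the new column is the one satisfying `HMat.IsGluingColumn`. -/
noncomputable def HMat.glue {M₁ M₂ : ℕ} (H₁ : Matrix (Fin M₁) (Fin M₁) ℝ)
    (H₂ : Matrix (Fin M₂) (Fin M₂) ℝ) :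
    Matrix (Fin (M₁ + 1 + M₂)) (Fin (M₁ + 1 + M₂)) ℝ :=
  HMat.glueWith H₁ H₂
    (if h : ∃ c : Fin M₂ → ℝ, HMat.IsGluingColumn H₁ H₂ c then h.choose else 0)

/-! ### The Fractal Self-Dual Method -/

/-- The size `2 ^ n - 1` of the `n`-th matrix, in a form that makes gluing type-correct. -/
def fsdmSize : ℕ → ℕ
  | 0 => 0
  | n + 1 => fsdmSize n + 1 + fsdmSize n

theorem fsdmSize_eq (n : ℕ) : fsdmSize n = 2 ^ n - 1 := by
  have h : fsdmSize n + 1 = 2 ^ n := by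
    induction n with
    | zero => rfl
    | succ n ih => simp only [fsdmSize, pow_succ]; omega
  omega

/-- `H^{(n)} = H_FSDM (2 ^ n - 1)`: the empty matrix for `n = 0`, and
`H^{(n+1)} = H^{(n)} ⋈ (H^{(n)})ᴬ`. -/
noncomputable def fsdmH : (n : ℕ) → Matrix (Fin (fsdmSize n)) (Fin (fsdmSize n)) ℝ
  | 0 => 0
  | n + 1 => HMat.glue (fsdmH n) (HMat.dual (fsdmH n))

/-- The entries `a^{(n)}_j`, `1 ≤ j ≤ 2 ^ n - 1`, of the row vectors
`a^{(n+1)} = [ a^{(n)} / 2, (2 ^ n + 1) / 4, a^{(n)} ]`, where `a^{(0)}` is empty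
(so `a^{(1)} = [1/2]`). -/
noncomputable def fsdmA : ℕ → ℕ → ℝ
  | 0, _ => 0
  | n + 1, j =>
      if j < 2 ^ n then fsdmA n j / 2
      else if j = 2 ^ n then ((2 : ℝ) ^ n + 1) / 4
      else fsdmA n (j - 2 ^ n)

/-- The column vector `b^{(n)}`: the entries of `a^{(n)}` in reversed order. -/
noncomputable def fsdmB (n j : ℕ) : ℝ := fsdmA n (2 ^ n - j)

/-- The sequence `y` is produced by FSDM for the operator `T`: for every `n`, its first
`2 ^ n - 1` iterations are those of the fixed-step method with H-matrix `H^{(n)}`,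
`y_{k+1} = y_k - ∑_{j=0}^k h_{k+1,j+1} (y_j - T y_j)`. -/
def IsFSDM {X : Type u} [NormedAddCommGroup X] [InnerProductSpace ℝ X]
    (T : X → X) (y : ℕ → X) : Prop :=
  ∀ n k : ℕ, k < fsdmSize n →
    y (k + 1) = y k -
      ∑ j ∈ Finset.range (k + 1), HMat.entry (fsdmH n) (k + 1) (j + 1) • (y j - T (y j))

/-- `g_t = (y_{t-1} - T y_{t-1}) / 2` for `t ≥ 1`. -/
noncomputable def fsdmG {X : Type u} [NormedAddCommGroup X] [InnerProductSpace ℝ X]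
    (T : X → X) (y : ℕ → X) (t : ℕ) : X :=
  (1 / 2 : ℝ) • (y (t - 1) - T (y (t - 1)))

/-- `m(j) = j - 2 ^ ν₂(j)`. -/
def fsdmM (j : ℕ) : ℕ := j - 2 ^ padicValNat 2 j

/-! ### Memory

Memory is counted in stored vectors of `X`. The machine has registers `R_0, R_1, …`, each
holding one vector; the only way to use the operator is to apply it to a register. -/

/-- An instruction: `R_dst := T R_src`, or `R_dst := α R_a + β R_b`. -/
inductive VecInstr where
  | query (dst src : ℕ)
  | comb (dst : ℕ) (α : ℝ) (a : ℕ) (β : ℝ) (b : ℕ)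

/-- The registers that an instruction reads or writes. -/
def VecInstr.regs : VecInstr → Finset ℕ
  | .query dst src => {dst, src}
  | .comb dst _ a _ b => {dst, a, b}

/-- Whether an instruction evaluates the operator. -/
def VecInstr.isQuery : VecInstr → Bool
  | .query _ _ => true
  | .comb _ _ _ _ _ => false

/-- The effect of one instruction on the register contents. -/
noncomputable def VecInstr.exec {X : Type u} [NormedAddCommGroup X] [InnerProductSpace ℝ X]
    (T : X → X) (R : ℕ → X) : VecInstr → ℕ → X
  | .query dst src => Function.update R dst (T (R src))
  | .comb dst α a β b => Function.update R dst (α • R a + β • R b)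

/-- The register contents after running the instruction lists `P 1, …, P j` in this order,
starting from the contents `R`. -/
noncomputable def runIterations {X : Type u} [NormedAddCommGroup X] [InnerProductSpace ℝ X]
    (T : X → X) (P : ℕ → List VecInstr) (R : ℕ → X) : ℕ → ℕ → X
  | 0 => R
  | j + 1 => (P (j + 1)).foldl (VecInstr.exec T) (runIterations T P R j)

/-!
Call a sequence `j(1) ≤ i(1) < j(2) ≤ i(2) < ⋯` weighted by `∏ h_{i(r),j(r)}` a chain, and let
`F` be the generating function of all chains of `H^{(n)}` by the number of factors, the empty
chain included (`HMat.tailSeries _ 1`).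

*Gluing.* The equations for the new column are a triangular linear system whose diagonal consists
of products of diagonal entries of `H₂`, so a solution is unique (`HMat.IsGluingColumn.unique`).
For existence let `H` be self-dual with column sums `a` and row sums `b`. With the middle row
`-a / 2`, the middle diagonal entry `N / 2` for `N = 2 ^ n`, and the column `-b / 2`, replacing the
last (first) row (column) index of a chain by the middle one costs the factor `-1 / 2`, which gives
the generating function `F + (N / 2) X F²` for the glued matrix. Hence `1 + N X F = (1 + X) ^ N` is
preserved, as the left-hand side is squared. Its coefficients are the binomial numbers that turn
the equations of the gluing column into an identity (`isGluingColumn_fractalColumn`). The matrix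
prescribed by the block structure (`fractalEntry`) is symmetric along the anti-diagonal and its
column sums follow the recursion of `a^{(n)}`, so it equals `H^{(n)}` by induction
(`entry_fsdmH`).

*Recurrence.* All `H^{(n)}` are leading blocks of one infinite lower triangular matrix. For
`j = m + 2 ^ L` with `L = ν₂(j)`, add to the `j`-th update half the sum of the updates from
`m + 1` to `j - 1`; this half is `(y_m - y_{j-1}) / 2`. If `m = 0`, the
entries `-a / 2` of the row cancel against half the column sums of the block above it.
Removing the leading binary digit `2 ^ i` of `m` passes to the trailing
block of `H^{(i+1)}` and produces one term at `g_{2 ^ i}`, whose coefficient is the same expression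
for row sums; as row sums are halved on passing to a trailing block, it is
`2 ^ L / 2 ^ p` (`foldedUpdate_binarySum`).

*Memory.* The recurrence for `j` uses only `y_m` for the prefix `m` of the binary expansion of `j`,
the vectors `g_t` for the prefixes `t` of `m`, and `y_{j-1}`. A register pair for each binary digit
holding `y_t` and `g_t` for the prefix ending there therefore suffices, and each iteration
overwrites, among these pairs, only the one of the lowest digit of `j`
(`RegisterInvariant.step`).
-/

/-! ### Generating functions of chains -/

theorem HMat.entry_ofEntries (M : ℕ) (f : ℕ → ℕ → ℝ) {k j : ℕ} (hk : 1 ≤ k) (hk' : k ≤ M)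
    (hj : 1 ≤ j) (hj' : j ≤ M) : HMat.entry (HMat.ofEntries M f) k j = f k j := by
  simp [HMat.entry, HMat.ofEntries, hk, hk', hj, hj']

theorem HMat.entry_of_not {M : ℕ} (H : Matrix (Fin M) (Fin M) ℝ) {k j : ℕ}
    (h : ¬((1 ≤ k ∧ k ≤ M) ∧ (1 ≤ j ∧ j ≤ M))) : HMat.entry H k j = 0 := by
  rw [HMat.entry, dif_neg h]

theorem HMat.ext_entry {M : ℕ} {H H' : Matrix (Fin M) (Fin M) ℝ}
    (h : ∀ k j, 1 ≤ k → k ≤ M → 1 ≤ j → j ≤ M → HMat.entry H k j = HMat.entry H' k j) :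
    H = H' := by
  ext a b
  have := h (a + 1) (b + 1) (by omega) (by omega) (by omega) (by omega)
  simpa [HMat.entry, Nat.succ_le_iff] using this

/-- The sum of the products over all chains with `m` factors that start at an index `≥ l`,
where the empty chain counts `1`. -/
noncomputable def HMat.tail {M : ℕ} (H : Matrix (Fin M) (Fin M) ℝ) : ℕ → ℕ → ℝ
  | 0, _ => 1
  | m + 1, l => ∑ j ∈ Finset.Icc l M, HMat.Q H (m + 1) j

section Tail

variable {M : ℕ} (H : Matrix (Fin M) (Fin M) ℝ)

theorem HMat.Q_succ (m j : ℕ) :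
    HMat.Q H (m + 1) j = ∑ i ∈ Finset.Icc j M, HMat.entry H i j * HMat.tail H m (i + 1) := by
  cases m with
  | zero => simp [HMat.Q, HMat.tail]
  | succ m => simp only [HMat.Q, HMat.tail]

theorem HMat.tail_succ_of_le (m : ℕ) {l : ℕ} (hl : l ≤ M) :
    HMat.tail H (m + 1) l = HMat.Q H (m + 1) l + HMat.tail H (m + 1) (l + 1) := by
  simp only [HMat.tail]
  rw [← Finset.insert_Icc_add_one_left_eq_Icc hl, Finset.sum_insert (by simp)]

theorem HMat.tail_eq_zero (m : ℕ) {l : ℕ} (hl : l ≤ M + 1) (h : M + 1 < l + m) :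
    HMat.tail H m l = 0 := by
  induction m generalizing l with
  | zero => omega
  | succ m ih =>
    refine Finset.sum_eq_zero fun j hj => ?_
    rw [HMat.Q_succ]
    refine Finset.sum_eq_zero fun i hi => ?_
    rw [Finset.mem_Icc] at hi hj
    rw [ih (by omega) (by omega), mul_zero]

/-- A chain with `m` factors starting at an index `≥ M + 1 - m` must use the last `m`
diagonal entries, so the sum over these chains is their product. -/
theorem HMat.tail_ne_zero (hd : ∀ i, 1 ≤ i → i ≤ M → HMat.entry H i i ≠ 0) {m : ℕ}
    (hm : m ≤ M) : HMat.tail H m (M + 1 - m) ≠ 0 := by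
  induction m with
  | zero => simp [HMat.tail]
  | succ m ih =>
    rw [HMat.tail_succ_of_le _ _ (by omega), HMat.tail_eq_zero H (m + 1) (by omega) (by omega),
      add_zero, HMat.Q_succ, Finset.sum_eq_single_of_mem (M + 1 - (m + 1))
        (Finset.mem_Icc.2 ⟨le_rfl, by omega⟩)]
    · refine mul_ne_zero (hd _ (by omega) (by omega)) ?_
      rw [show M + 1 - (m + 1) + 1 = M + 1 - m by omega]
      exact ih (by omega)
    · intro i hi hne
      rw [Finset.mem_Icc] at hi
      rw [HMat.tail_eq_zero H m (by omega) (by omega), mul_zero]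

/-- Prefixing a chain by an arbitrary entry of the row where the new factor ends extends it by
one factor. -/
theorem HMat.sum_rowSum_mul_tail (m : ℕ) :
    ∑ i ∈ Finset.Icc 1 M, (∑ j ∈ Finset.Icc 1 i, HMat.entry H i j) * HMat.tail H m (i + 1) =
      HMat.tail H (m + 1) 1 := by
  rw [HMat.tail]
  simp only [HMat.Q_succ, Finset.sum_mul]
  refine Finset.sum_comm' fun i j => ?_
  simp only [Finset.mem_Icc]
  omega

open PowerSeries

/-- The generating function, in the number of factors, of the chains starting at an index
`≥ l`. -/
noncomputable def HMat.tailSeries (l : ℕ) : PowerSeries ℝ :=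
  PowerSeries.mk fun m => HMat.tail H m l

theorem HMat.tailSeries_succ_size : HMat.tailSeries H (M + 1) = 1 := by
  ext m
  cases m with
  | zero => simp [HMat.tailSeries, HMat.tail]
  | succ m => simp [HMat.tailSeries, HMat.tail, PowerSeries.coeff_one]

theorem HMat.tailSeries_of_le {l : ℕ} (hl : l ≤ M) :
    HMat.tailSeries H l = HMat.tailSeries H (l + 1) +
      X * ∑ i ∈ Finset.Icc l M, C (HMat.entry H i l) * HMat.tailSeries H (i + 1) := by
  ext m
  cases m with
  | zero => simp [HMat.tailSeries, HMat.tail]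
  | succ m =>
    rw [map_add, coeff_succ_X_mul]
    simp only [HMat.tailSeries, coeff_mk, map_sum, coeff_C_mul]
    rw [HMat.tail_succ_of_le H m hl, HMat.Q_succ, add_comm]

theorem HMat.X_mul_sum_rowSum_mul_tailSeries :
    X * ∑ i ∈ Finset.Icc 1 M,
        C (∑ j ∈ Finset.Icc 1 i, HMat.entry H i j) * HMat.tailSeries H (i + 1) =
      HMat.tailSeries H 1 - 1 := by
  ext m
  cases m with
  | zero => simp [HMat.tailSeries, HMat.tail]
  | succ m =>
    rw [coeff_succ_X_mul]
    rw [map_sum]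
    simp only [HMat.tailSeries, coeff_mk, coeff_C_mul, map_sub, PowerSeries.coeff_one]
    simpa using HMat.sum_rowSum_mul_tail H m

end Tail

/-! ### Chains of a glued matrix -/

section Glue

variable {M₁ M₂ : ℕ} (H₁ : Matrix (Fin M₁) (Fin M₁) ℝ) (H₂ : Matrix (Fin M₂) (Fin M₂) ℝ)
  (c : Fin M₂ → ℝ)

theorem HMat.entry_glueWith_trailing {k j : ℕ} (hk : 1 ≤ k) (hj : 1 ≤ j) :
    HMat.entry (HMat.glueWith H₁ H₂ c) (M₁ + 1 + k) (M₁ + 1 + j) = HMat.entry H₂ k j := by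
  by_cases h : k ≤ M₂ ∧ j ≤ M₂
  · rw [HMat.glueWith, HMat.entry_ofEntries _ _ (by omega) (by omega) (by omega) (by omega)]
    rw [if_neg (by omega), if_neg (by omega), if_neg (by omega), if_neg (by omega)]
    congr 1 <;> omega
  · rw [HMat.entry_of_not _ (by omega), HMat.entry_of_not _ (by omega)]

theorem HMat.entry_glueWith_leading {k j : ℕ} (hk : 1 ≤ k) (hk' : k ≤ M₁) (hj : 1 ≤ j)
    (hj' : j ≤ M₁) :
    HMat.entry (HMat.glueWith H₁ H₂ c) k j = HMat.entry H₁ k j := by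
  rw [HMat.glueWith, HMat.entry_ofEntries _ _ (by omega) (by omega) (by omega) (by omega)]
  rw [if_pos (by omega)]

theorem HMat.entry_glueWith_row {j : ℕ} (hj : 1 ≤ j) (hj' : j ≤ M₁) :
    HMat.entry (HMat.glueWith H₁ H₂ c) (M₁ + 1) j =
      -(((M₂ : ℝ) + 1) / ((M₁ : ℝ) + M₂ + 2)) * ∑ i ∈ Finset.Icc j M₁, HMat.entry H₁ i j := by
  rw [HMat.glueWith, HMat.entry_ofEntries _ _ (by omega) (by omega) (by omega) (by omega)]
  rw [if_neg (by omega), if_pos rfl, if_pos (by omega)]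

theorem HMat.entry_glueWith_diag :
    HMat.entry (HMat.glueWith H₁ H₂ c) (M₁ + 1) (M₁ + 1) =
      ((M₁ : ℝ) + 1) * ((M₂ : ℝ) + 1) / ((M₁ : ℝ) + M₂ + 2) := by
  rw [HMat.glueWith, HMat.entry_ofEntries _ _ (by omega) (by omega) (by omega) (by omega)]
  rw [if_neg (by omega), if_pos rfl, if_neg (by omega), if_pos rfl]

theorem HMat.entry_glueWith_column (i : Fin M₂) :
    HMat.entry (HMat.glueWith H₁ H₂ c) (M₁ + 1 + (i + 1)) (M₁ + 1) = c i := by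
  rw [HMat.glueWith, HMat.entry_ofEntries _ _ (by omega) (by omega) (by omega) (by omega)]
  rw [if_neg (by omega), if_neg (by omega), if_neg (by omega), if_pos rfl, dif_pos (by omega)]
  congr 1
  ext
  simp
  omega

theorem HMat.entry_glueWith_lower_left {k j : ℕ} (hk : M₁ + 1 < k) (hj : j ≤ M₁) :
    HMat.entry (HMat.glueWith H₁ H₂ c) k j = 0 := by
  by_cases h : k ≤ M₁ + 1 + M₂ ∧ 1 ≤ j
  · rw [HMat.glueWith, HMat.entry_ofEntries _ _ (by omega) (by omega) (by omega) (by omega)]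
    rw [if_neg (by omega), if_neg (by omega), if_pos (by omega)]
  · exact HMat.entry_of_not _ (by omega)

theorem HMat.sum_Icc_trailing {A : Type*} [AddCommMonoid A] (f : ℕ → A) (l : ℕ) :
    ∑ j ∈ Finset.Icc (M₁ + 1 + l) (M₁ + 1 + M₂), f j =
      ∑ j ∈ Finset.Icc l M₂, f (M₁ + 1 + j) := by
  rw [← Finset.map_add_left_Icc, Finset.sum_map]
  rfl

/-- A sum over the rows `≥ N'`, where `N' = M₁ + 1`, split at the row `N'`. -/
theorem HMat.sum_Icc_middle {A : Type*} [AddCommMonoid A] (f : ℕ → A) :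
    ∑ j ∈ Finset.Icc (M₁ + 1) (M₁ + 1 + M₂), f j =
      f (M₁ + 1) + ∑ i : Fin M₂, f (M₁ + 1 + (i + 1)) := by
  rw [← Finset.insert_Icc_add_one_left_eq_Icc (by omega), Finset.sum_insert (by simp),
    HMat.sum_Icc_trailing f 1, Finset.sum_fin_eq_sum_range,
    ← Finset.Ico_add_one_right_eq_Icc, Finset.sum_Ico_eq_sum_range]
  congr 1
  refine Finset.sum_congr rfl fun i hi => ?_
  rw [Finset.mem_range] at hi
  rw [dif_pos (by omega), add_comm 1 i]

theorem HMat.tail_glueWith_trailing (m : ℕ) {l : ℕ} (hl : 1 ≤ l) :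
    HMat.tail (HMat.glueWith H₁ H₂ c) m (M₁ + 1 + l) = HMat.tail H₂ m l := by
  induction m generalizing l with
  | zero => simp [HMat.tail]
  | succ m ih =>
    rw [HMat.tail, HMat.tail, HMat.sum_Icc_trailing]
    refine Finset.sum_congr rfl fun j hj => ?_
    rw [HMat.Q_succ, HMat.Q_succ, HMat.sum_Icc_trailing]
    refine Finset.sum_congr rfl fun i hi => ?_
    rw [Finset.mem_Icc] at hi hj
    rw [HMat.entry_glueWith_trailing _ _ _ (by omega) (by omega)]
    exact congrArg _ (ih (l := i + 1) (by omega))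

theorem HMat.Q_glueWith (m : ℕ) :
    HMat.Q (HMat.glueWith H₁ H₂ c) (m + 1) (M₁ + 1) =
      ((M₁ : ℝ) + 1) * ((M₂ : ℝ) + 1) / ((M₁ : ℝ) + M₂ + 2) * HMat.tail H₂ m 1 +
        ∑ i : Fin M₂, c i * HMat.tail H₂ m (i + 2) := by
  rw [HMat.Q_succ, HMat.sum_Icc_middle, HMat.entry_glueWith_diag,
    HMat.tail_glueWith_trailing _ _ _ _ le_rfl]
  congr 1
  refine Finset.sum_congr rfl fun i _ => ?_
  rw [HMat.entry_glueWith_column]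
  exact congrArg _ (HMat.tail_glueWith_trailing H₁ H₂ c m (l := i + 2) (by omega))

/-- The equations of the gluing column form a triangular linear system, with products of
diagonal entries of `H₂` on its diagonal. -/
theorem HMat.IsGluingColumn.unique
    (hd : ∀ i, 1 ≤ i → i ≤ M₂ → HMat.entry H₂ i i ≠ 0) {c c' : Fin M₂ → ℝ}
    (hc : HMat.IsGluingColumn H₁ H₂ c) (hc' : HMat.IsGluingColumn H₁ H₂ c') : c = c' := by
  have key : ∀ m ≤ M₂, ∑ i : Fin M₂, (c i - c' i) * HMat.tail H₂ m (i + 2) = 0 := by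
    intro m hm
    have h := (hc (m + 1) (by omega) (by omega)).trans (hc' (m + 1) (by omega) (by omega)).symm
    rw [HMat.Q_glueWith, HMat.Q_glueWith, add_right_inj] at h
    simp only [sub_mul, Finset.sum_sub_distrib]
    linarith
  have main : ∀ i : ℕ, ∀ h : i < M₂, c ⟨i, h⟩ - c' ⟨i, h⟩ = 0 := by
    intro i
    induction i using Nat.strong_induction_on with
    | _ i ih =>
      intro h
      -- with this number of factors, the coefficients of the later unknowns vanish
      have h1 := key (M₂ - 1 - i) (by omega)
      rw [Finset.sum_eq_single_of_mem ⟨i, h⟩ (Finset.mem_univ _)] at h1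
      · refine (mul_eq_zero.1 h1).resolve_right ?_
        have := HMat.tail_ne_zero H₂ hd (m := M₂ - 1 - i) (by omega)
        rwa [show M₂ + 1 - (M₂ - 1 - i) = i + 2 by omega] at this
      · intro b _ hb
        have hb' : (b : ℕ) ≠ i := fun h => hb (Fin.ext h)
        rcases lt_or_gt_of_ne hb' with hlt | hgt
        · rw [ih b hlt b.2, zero_mul]
        · rw [HMat.tail_eq_zero H₂ _ (by omega) (by omega), mul_zero]
  funext i
  exact sub_eq_zero.1 (main i i.2)

open PowerSeries

theorem HMat.tailSeries_glueWith_trailing {l : ℕ} (hl : 1 ≤ l) :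
    HMat.tailSeries (HMat.glueWith H₁ H₂ c) (M₁ + 1 + l) = HMat.tailSeries H₂ l := by
  ext m
  simp [HMat.tailSeries, HMat.tail_glueWith_trailing H₁ H₂ c m hl]

theorem HMat.tailSeries_glueWith_middle :
    HMat.tailSeries (HMat.glueWith H₁ H₂ c) (M₁ + 1) =
      HMat.tailSeries H₂ 1 +
        X * (C (((M₁ : ℝ) + 1) * ((M₂ : ℝ) + 1) / ((M₁ : ℝ) + M₂ + 2)) * HMat.tailSeries H₂ 1 +
          ∑ i : Fin M₂, C (c i) * HMat.tailSeries H₂ (i + 2)) := by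
  rw [HMat.tailSeries_of_le _ (by omega), HMat.sum_Icc_middle, HMat.entry_glueWith_diag,
    HMat.tailSeries_glueWith_trailing _ _ _ le_rfl]
  congr 3
  refine Finset.sum_congr rfl fun i _ => ?_
  rw [HMat.entry_glueWith_column]
  exact congrArg _ (HMat.tailSeries_glueWith_trailing H₁ H₂ c (l := i + 2) (by omega))

/-- As the entries of the middle row are proportional to the column sums of `H₁`, the tail
series of the glued matrix, corrected by a multiple of the tail series of `H₂`, satisfies the
homogeneous recursion of the tail series of `H₁`. -/
theorem HMat.tailSeries_glueWith_leading {l : ℕ} (hl : 1 ≤ l) (hl' : l ≤ M₁ + 1) :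
    HMat.tailSeries (HMat.glueWith H₁ H₂ c) l -
        C (((M₂ : ℝ) + 1) / ((M₁ : ℝ) + M₂ + 2)) * HMat.tailSeries H₂ 1 =
      (HMat.tailSeries (HMat.glueWith H₁ H₂ c) (M₁ + 1) -
        C (((M₂ : ℝ) + 1) / ((M₁ : ℝ) + M₂ + 2)) * HMat.tailSeries H₂ 1) *
          HMat.tailSeries H₁ l := by
  set θ : ℝ := ((M₂ : ℝ) + 1) / ((M₁ : ℝ) + M₂ + 2) with hθ
  set W : ℕ → PowerSeries ℝ := fun l =>
    HMat.tailSeries (HMat.glueWith H₁ H₂ c) l - C θ * HMat.tailSeries H₂ 1 with hW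
  change W l = W (M₁ + 1) * HMat.tailSeries H₁ l
  have hrec : ∀ l, 1 ≤ l → l ≤ M₁ →
      W l = W (l + 1) + X * ∑ i ∈ Finset.Icc l M₁, C (HMat.entry H₁ i l) * W (i + 1) := by
    intro l h1 h2
    simp only [hW]
    rw [HMat.tailSeries_of_le _ (by omega : l ≤ M₁ + 1 + M₂)]
    have hsplit : ∑ i ∈ Finset.Icc l (M₁ + 1 + M₂),
          C (HMat.entry (HMat.glueWith H₁ H₂ c) i l) *
            HMat.tailSeries (HMat.glueWith H₁ H₂ c) (i + 1) =
        ∑ i ∈ Finset.Icc l (M₁ + 1), C (HMat.entry (HMat.glueWith H₁ H₂ c) i l) *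
            HMat.tailSeries (HMat.glueWith H₁ H₂ c) (i + 1) := by
      symm
      refine Finset.sum_subset (Finset.Icc_subset_Icc_right (by omega)) fun i hi hi' => ?_
      rw [Finset.mem_Icc] at hi hi'
      rw [HMat.entry_glueWith_lower_left _ _ _ (by omega) h2, map_zero, zero_mul]
    rw [hsplit, Finset.sum_Icc_succ_top (by omega), HMat.entry_glueWith_row _ _ _ h1 h2,
      HMat.tailSeries_glueWith_trailing _ _ _ le_rfl]
    have hlead : ∑ i ∈ Finset.Icc l M₁, C (HMat.entry (HMat.glueWith H₁ H₂ c) i l) *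
            HMat.tailSeries (HMat.glueWith H₁ H₂ c) (i + 1) =
        ∑ i ∈ Finset.Icc l M₁, C (HMat.entry H₁ i l) *
            HMat.tailSeries (HMat.glueWith H₁ H₂ c) (i + 1) := by
      refine Finset.sum_congr rfl fun i hi => ?_
      rw [Finset.mem_Icc] at hi
      rw [HMat.entry_glueWith_leading _ _ _ (by omega) (by omega) h1 h2]
    rw [hlead]
    simp only [mul_sub, Finset.sum_sub_distrib, ← Finset.sum_mul, map_mul, map_neg, map_sum]
    ring
  induction hk : M₁ + 1 - l using Nat.strong_induction_on generalizing l with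
  | _ k ih =>
    rcases eq_or_lt_of_le hl' with rfl | hlt
    · rw [HMat.tailSeries_succ_size, mul_one]
    · rw [hrec l hl (by omega), HMat.tailSeries_of_le H₁ (by omega : l ≤ M₁),
        ih (M₁ + 1 - (l + 1)) (by omega) (by omega) (by omega) rfl, mul_add,
        mul_left_comm (W (M₁ + 1)) X, Finset.mul_sum _ _ (W (M₁ + 1))]
      refine congrArg₂ _ rfl (congrArg _ (Finset.sum_congr rfl fun i hi => ?_))
      rw [Finset.mem_Icc] at hi
      rw [ih (M₁ + 1 - (i + 1)) (by omega) (by omega) (by omega) rfl, mul_left_comm]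

end Glue

/-! ### The matrix with the fractal block structure -/

/-- The entries of `H^{(n)}` as prescribed by the fractal block structure. Indices outside
`1, …, 2 ^ n - 1` give `0`. -/
noncomputable def fractalEntry : ℕ → ℕ → ℕ → ℝ
  | 0, _, _ => 0
  | n + 1, k, j =>
      if k < 2 ^ n then (if j < 2 ^ n then fractalEntry n k j else 0)
      else if k = 2 ^ n then
        (if j < 2 ^ n then -(1 / 2 : ℝ) * fsdmA n j
         else if j = 2 ^ n then (2 : ℝ) ^ n / 2
         else 0)
      else
        (if j < 2 ^ n then 0
         else if j = 2 ^ n then -(1 / 2 : ℝ) * fsdmB n (k - 2 ^ n)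
         else fractalEntry n (k - 2 ^ n) (j - 2 ^ n))

theorem fsdmA_zero_right (n : ℕ) : fsdmA n 0 = 0 := by
  induction n with
  | zero => rfl
  | succ n ih => simp [fsdmA, ih]

theorem fsdmA_of_le {n j : ℕ} (h : 2 ^ n ≤ j) : fsdmA n j = 0 := by
  induction n generalizing j with
  | zero => rfl
  | succ n ih =>
    have h0 : 0 < 2 ^ n := by positivity
    rw [pow_succ] at h
    rw [fsdmA, if_neg (by omega), if_neg (by omega), ih (by omega)]

theorem fsdmA_add {n j : ℕ} (h : 0 < j) : fsdmA (n + 1) (2 ^ n + j) = fsdmA n j := by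
  rw [fsdmA, if_neg (by omega), if_neg (by omega), Nat.add_sub_cancel_left]

theorem fsdmB_zero_right (n : ℕ) : fsdmB n 0 = 0 := fsdmA_of_le (by simp)

theorem fsdmB_of_le {n j : ℕ} (h : 2 ^ n ≤ j) : fsdmB n j = 0 := by
  rw [fsdmB, Nat.sub_eq_zero_of_le h, fsdmA_zero_right]

theorem fsdmB_succ_of_lt {n j : ℕ} (h : j < 2 ^ n) : fsdmB (n + 1) j = fsdmB n j := by
  rw [fsdmB, pow_succ, show 2 ^ n * 2 - j = 2 ^ n + (2 ^ n - j) by omega, fsdmA_add (by omega)]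
  rfl

theorem fsdmB_succ_two_pow (n : ℕ) : fsdmB (n + 1) (2 ^ n) = ((2 : ℝ) ^ n + 1) / 4 := by
  rw [fsdmB, pow_succ, show 2 ^ n * 2 - 2 ^ n = 2 ^ n by omega, fsdmA, if_neg (by omega),
    if_pos rfl]

theorem fsdmB_succ_add {n j : ℕ} (h : 0 < j) : fsdmB (n + 1) (2 ^ n + j) = fsdmB n j / 2 := by
  have h0 : 0 < 2 ^ n := by positivity
  rw [fsdmB, pow_succ, show 2 ^ n * 2 - (2 ^ n + j) = 2 ^ n - j by omega, fsdmA,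
    if_pos (by omega)]
  rfl

theorem sum_range_two_pow_succ {A : Type*} [AddCommMonoid A] (f : ℕ → A) (n : ℕ) :
    ∑ j ∈ Finset.range (2 ^ (n + 1)), f j =
      ∑ j ∈ Finset.range (2 ^ n), f j + ∑ j ∈ Finset.range (2 ^ n), f (2 ^ n + j) := by
  rw [pow_succ, mul_two, Finset.sum_range_add]

theorem sum_range_eq_head_add {A : Type*} [AddCommMonoid A] (f : ℕ → A) {m : ℕ} (h : 0 < m) :
    ∑ j ∈ Finset.range m, f j = f 0 + ∑ j ∈ Finset.range (m - 1), f (j + 1) := by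
  obtain ⟨k, rfl⟩ : ∃ k, m = k + 1 := ⟨m - 1, by omega⟩
  rw [Finset.sum_range_succ', add_comm, Nat.add_sub_cancel]

/-- The entries of `-b^{(n)} / 2` together with the diagonal entry above them therefore add up to
the middle entry of `a^{(n+1)}`. -/
theorem sum_fsdmB (n : ℕ) : ∑ j ∈ Finset.range (2 ^ n), fsdmB n j = ((2 : ℝ) ^ n - 1) / 2 := by
  induction n with
  | zero => simp [fsdmB_zero_right]
  | succ n ih =>
    have h0 : 0 < 2 ^ n := by positivity
    rw [sum_range_two_pow_succ,
      sum_range_eq_head_add (fun j => fsdmB (n + 1) (2 ^ n + j)) h0]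
    have h1 : ∑ j ∈ Finset.range (2 ^ n), fsdmB (n + 1) j = ((2 : ℝ) ^ n - 1) / 2 := by
      rw [← ih]
      exact Finset.sum_congr rfl fun j hj => fsdmB_succ_of_lt (Finset.mem_range.1 hj)
    have h2 : ∑ j ∈ Finset.range (2 ^ n - 1), fsdmB (n + 1) (2 ^ n + (j + 1)) =
        ((2 : ℝ) ^ n - 1) / 4 := by
      rw [sum_range_eq_head_add _ h0, fsdmB_zero_right, zero_add] at ih
      rw [Finset.sum_congr rfl fun j _ => fsdmB_succ_add (by omega), ← Finset.sum_div, ih]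
      ring
    rw [h1, h2, add_zero, fsdmB_succ_two_pow]
    ring

theorem fractalEntry_zero_left (n j : ℕ) : fractalEntry n 0 j = 0 := by
  induction n with
  | zero => rfl
  | succ n ih => simp [fractalEntry, ih]

theorem fractalEntry_zero_right (n k : ℕ) : fractalEntry n k 0 = 0 := by
  induction n with
  | zero => rfl
  | succ n ih => simp [fractalEntry, ih, fsdmA_zero_right]

theorem fractalEntry_of_le_left {n k : ℕ} (j : ℕ) (h : 2 ^ n ≤ k) : fractalEntry n k j = 0 := by
  induction n generalizing k j with
  | zero => rfl
  | succ n ih =>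
    have h0 : 0 < 2 ^ n := by positivity
    rw [pow_succ] at h
    rw [fractalEntry, if_neg (by omega), if_neg (by omega), fsdmB_of_le (by omega),
      ih _ (by omega)]
    simp

theorem fractalEntry_of_lt {n k j : ℕ} (h : k < j) : fractalEntry n k j = 0 := by
  induction n generalizing k j with
  | zero => rfl
  | succ n ih =>
    rw [fractalEntry]
    split_ifs <;> first | rfl | omega | exact ih (by omega)

theorem fractalEntry_of_le_right {n j : ℕ} (k : ℕ) (h : 2 ^ n ≤ j) : fractalEntry n k j = 0 := by
  rcases lt_or_ge k j with hk | hk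
  · exact fractalEntry_of_lt hk
  · exact fractalEntry_of_le_left j (h.trans hk)

theorem fractalEntry_succ_of_lt {n k : ℕ} (j : ℕ) (h : k < 2 ^ n) :
    fractalEntry (n + 1) k j = fractalEntry n k j := by
  rw [fractalEntry, if_pos h]
  split_ifs with hj
  · rfl
  · rw [fractalEntry_of_le_right k (not_lt.1 hj)]

theorem fractalEntry_succ_two_pow_of_lt {n j : ℕ} (h : j < 2 ^ n) :
    fractalEntry (n + 1) (2 ^ n) j = -(1 / 2 : ℝ) * fsdmA n j := by
  rw [fractalEntry, if_neg (by omega), if_pos rfl, if_pos h]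

theorem fractalEntry_succ_two_pow_two_pow (n : ℕ) :
    fractalEntry (n + 1) (2 ^ n) (2 ^ n) = (2 : ℝ) ^ n / 2 := by
  rw [fractalEntry, if_neg (by omega), if_pos rfl, if_neg (by omega), if_pos rfl]

theorem fractalEntry_succ_add_of_lt {n k j : ℕ} (hk : 0 < k) (h : j < 2 ^ n) :
    fractalEntry (n + 1) (2 ^ n + k) j = 0 := by
  rw [fractalEntry, if_neg (by omega), if_neg (by omega), if_pos h]

theorem fractalEntry_succ_add_two_pow {n k : ℕ} (hk : 0 < k) :
    fractalEntry (n + 1) (2 ^ n + k) (2 ^ n) = -(1 / 2 : ℝ) * fsdmB n k := by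
  rw [fractalEntry, if_neg (by omega), if_neg (by omega), if_neg (by omega), if_pos rfl,
    Nat.add_sub_cancel_left]

theorem fractalEntry_succ_add_add {n k j : ℕ} (hk : 0 < k) (hj : 0 < j) :
    fractalEntry (n + 1) (2 ^ n + k) (2 ^ n + j) = fractalEntry n k j := by
  rw [fractalEntry, if_neg (by omega), if_neg (by omega), if_neg (by omega), if_neg (by omega),
    Nat.add_sub_cancel_left, Nat.add_sub_cancel_left]

/-- `H^{(n)}` is its own H-dual. -/
theorem fractalEntry_reflect {n k j : ℕ} (hk : k ≤ 2 ^ n) (hj : j ≤ 2 ^ n) :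
    fractalEntry n (2 ^ n - j) (2 ^ n - k) = fractalEntry n k j := by
  induction n generalizing k j with
  | zero => rfl
  | succ n ih =>
    rw [pow_succ, mul_two] at hk hj ⊢
    rcases lt_trichotomy k (2 ^ n) with h1 | rfl | h1
    · rw [fractalEntry_succ_of_lt _ h1]
      rcases lt_trichotomy j (2 ^ n) with h2 | rfl | h2
      · rw [Nat.add_sub_assoc h1.le, Nat.add_sub_assoc h2.le,
          fractalEntry_succ_add_add (by omega) (by omega), ih h1.le h2.le]
      · rw [fractalEntry_of_lt (by omega), fractalEntry_of_lt h1]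
      · rw [fractalEntry_of_lt (by omega), fractalEntry_of_lt (by omega)]
    · rw [Nat.add_sub_cancel]
      rcases lt_trichotomy j (2 ^ n) with h2 | rfl | h2
      · rw [Nat.add_sub_assoc h2.le, fractalEntry_succ_add_two_pow (by omega),
          fractalEntry_succ_two_pow_of_lt h2, fsdmB, Nat.sub_sub_self h2.le]
      · rw [Nat.add_sub_cancel]
      · rw [fractalEntry_of_lt (by omega), fractalEntry_of_lt h2]
    · obtain ⟨k, rfl⟩ := Nat.exists_eq_add_of_lt h1
      rw [add_assoc, Nat.add_sub_add_left]
      rcases lt_trichotomy j (2 ^ n) with h2 | rfl | h2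
      · rw [Nat.add_sub_assoc h2.le, fractalEntry_succ_add_of_lt (by omega) (by omega),
          fractalEntry_succ_add_of_lt (by omega) h2]
      · rw [Nat.add_sub_cancel, fractalEntry_succ_two_pow_of_lt (by omega),
          fractalEntry_succ_add_two_pow (by omega)]
        rfl
      · obtain ⟨j, rfl⟩ := Nat.exists_eq_add_of_lt h2
        rw [add_assoc, Nat.add_sub_add_left, fractalEntry_succ_of_lt _ (by omega),
          ih (by omega) (by omega), fractalEntry_succ_add_add (by omega) (by omega)]

/-- The column sums of `H^{(n)}` are the entries of `a^{(n)}`. -/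
theorem sum_fractalEntry_column (n j : ℕ) :
    ∑ i ∈ Finset.range (2 ^ n), fractalEntry n i j = fsdmA n j := by
  induction n generalizing j with
  | zero => simp [fractalEntry, fsdmA]
  | succ n ih =>
    have h0 : 0 < 2 ^ n := by positivity
    rw [sum_range_two_pow_succ,
      sum_range_eq_head_add (fun i => fractalEntry (n + 1) (2 ^ n + i) j) h0,
      Finset.sum_congr rfl fun i hi => fractalEntry_succ_of_lt j (Finset.mem_range.1 hi), ih,
      add_zero]
    rcases lt_trichotomy j (2 ^ n) with h | rfl | h
    · rw [fractalEntry_succ_two_pow_of_lt h, fsdmA, if_pos h, Finset.sum_eq_zero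
        fun i _ => fractalEntry_succ_add_of_lt (by omega) h]
      ring
    · have hB := sum_fsdmB n
      rw [sum_range_eq_head_add _ h0, fsdmB_zero_right, zero_add] at hB
      rw [fractalEntry_succ_two_pow_two_pow, fsdmA_of_le le_rfl,
        Finset.sum_congr rfl fun i _ => fractalEntry_succ_add_two_pow (by omega),
        ← Finset.mul_sum, hB, fsdmA, if_neg (by omega), if_pos rfl]
      ring
    · obtain ⟨j, rfl⟩ := Nat.exists_eq_add_of_lt h
      rw [add_assoc, fsdmA_of_le (by omega), fractalEntry_of_lt (by omega),
        Finset.sum_congr rfl fun i _ => fractalEntry_succ_add_add (by omega) (by omega),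
        fsdmA_add (by omega), ← ih (j + 1), sum_range_eq_head_add _ h0, fractalEntry_zero_left,
        zero_add]

/-- The row sums of `H^{(n)}` are the entries of `b^{(n)}`. -/
theorem sum_fractalEntry_row {n k : ℕ} (hk : k ≤ 2 ^ n) :
    ∑ j ∈ Finset.range (2 ^ n + 1), fractalEntry n k j = fsdmB n k := by
  rw [fsdmB, ← sum_fractalEntry_column,
    ← Finset.sum_range_reflect (fun i => fractalEntry n i (2 ^ n - k)), Finset.sum_range_succ',
    fractalEntry_zero_right, add_zero]
  refine Finset.sum_congr rfl fun j hj => ?_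
  rw [Finset.mem_range] at hj
  rw [← fractalEntry_reflect hk (by omega)]
  congr 1
  omega

/-! ### The gluing column of the fractal matrices -/

theorem fsdmSize_add_one (n : ℕ) : fsdmSize n + 1 = 2 ^ n := by
  have h0 : 0 < 2 ^ n := by positivity
  rw [fsdmSize_eq]
  omega

theorem padicValNat_two_pow_add {n s : ℕ} (h0 : 0 < s) (h : s < 2 ^ n) :
    padicValNat 2 (2 ^ n + s) = padicValNat 2 s := by
  have hdvd : ∀ e, 2 ^ e ∣ 2 ^ n + s ↔ 2 ^ e ∣ s := by
    intro e
    rcases le_or_gt e n with he | he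
    · exact Nat.dvd_add_right (pow_dvd_pow 2 he)
    · have hlt : 2 ^ n * 2 ≤ 2 ^ e := by
        rw [← pow_succ]
        exact Nat.pow_le_pow_right two_pos he
      constructor <;> intro hd <;> have := Nat.le_of_dvd (by omega) hd <;> omega
  refine le_antisymm ?_ ?_
  · exact (padicValNat_dvd_iff_le (by omega)).1 ((hdvd _).1 pow_padicValNat_dvd)
  · exact (padicValNat_dvd_iff_le (by omega)).1 ((hdvd _).2 pow_padicValNat_dvd)

theorem fractalEntry_diag {n i : ℕ} (h0 : 0 < i) (h : i < 2 ^ n) :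
    fractalEntry n i i = (2 : ℝ) ^ padicValNat 2 i / 2 := by
  induction n generalizing i with
  | zero => simp at h; omega
  | succ n ih =>
    rw [pow_succ] at h
    rcases lt_trichotomy i (2 ^ n) with h1 | rfl | h1
    · rw [fractalEntry_succ_of_lt _ h1, ih h0 h1]
    · rw [fractalEntry_succ_two_pow_two_pow, padicValNat.prime_pow]
    · obtain ⟨i, rfl⟩ := Nat.exists_eq_add_of_lt h1
      rw [add_assoc, fractalEntry_succ_add_add (by omega) (by omega), ih (by omega) (by omega),
        padicValNat_two_pow_add (by omega) (by omega)]

/-- The candidate for the gluing column of the `n`-th gluing step. -/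
noncomputable def fractalColumn (n : ℕ) (i : Fin (fsdmSize n)) : ℝ :=
  -(1 / 2 : ℝ) * fsdmB n (i + 1)

open PowerSeries in
/-- Reads off the coefficients of the generating function: there are `binom (N, m + 1) / N`
chains with `m` factors, counted with weights, where `N = 2 ^ n`. -/
theorem two_pow_mul_tail_eq_choose {n M : ℕ} {H : Matrix (Fin M) (Fin M) ℝ}
    (hF : 1 + C ((2 : ℝ) ^ n) * X * HMat.tailSeries H 1 = (1 + X) ^ 2 ^ n) (m : ℕ) :
    (2 : ℝ) ^ n * HMat.tail H m 1 = (Nat.choose (2 ^ n) (m + 1) : ℝ) := by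
  have h := congrArg (coeff (m + 1)) hF
  -- the binomial theorem is available for the coefficients of polynomials
  have hpoly : ((1 + X) ^ 2 ^ n : PowerSeries ℝ) =
      (((1 + Polynomial.X) ^ 2 ^ n : Polynomial ℝ) : PowerSeries ℝ) := by simp
  rw [hpoly, Polynomial.coeff_coe, Polynomial.coeff_one_add_X_pow, map_add, mul_assoc,
    coeff_C_mul, coeff_succ_X_mul, PowerSeries.coeff_one, if_neg (by omega), zero_add] at h
  simpa [HMat.tailSeries] using h

section Step

variable {n : ℕ} {H : Matrix (Fin (fsdmSize n)) (Fin (fsdmSize n)) ℝ}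
  (hH : ∀ k j, HMat.entry H k j = fractalEntry n k j)

include hH

theorem dual_eq_self_of_entry_eq_fractalEntry : HMat.dual H = H := by
  refine HMat.ext_entry fun k j hk hk' hj hj' => ?_
  have hn := fsdmSize_add_one n
  rw [HMat.dual, HMat.entry_ofEntries _ _ hk hk' hj hj', hH, hH, hn,
    fractalEntry_reflect (by omega) (by omega)]

theorem sum_Icc_entry_row_eq_fsdmB {i : ℕ} (hi : i ≤ fsdmSize n) :
    ∑ j ∈ Finset.Icc 1 i, HMat.entry H i j = fsdmB n i := by
  have hn := fsdmSize_add_one n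
  rw [← sum_fractalEntry_row (by omega : i ≤ 2 ^ n)]
  simp only [hH]
  refine Finset.sum_subset (fun j hj => ?_) fun j hj hj' => ?_
  · simp only [Finset.mem_Icc, Finset.mem_range] at *
    omega
  · rw [Finset.mem_Icc, not_and_or, not_le, not_le] at hj'
    rcases hj' with h | h
    · rw [show j = 0 by omega, fractalEntry_zero_right]
    · exact fractalEntry_of_lt h

theorem sum_Icc_entry_column_eq_fsdmA (j : ℕ) :
    ∑ i ∈ Finset.Icc j (fsdmSize n), HMat.entry H i j = fsdmA n j := by
  have hn := fsdmSize_add_one n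
  rw [← sum_fractalEntry_column]
  simp only [hH]
  refine Finset.sum_subset (fun j hj => ?_) fun i hi hi' => ?_
  · simp only [Finset.mem_Icc, Finset.mem_range] at *
    omega
  · rw [Finset.mem_Icc, not_and_or, not_le, not_le] at hi'
    rw [Finset.mem_range] at hi
    exact fractalEntry_of_lt (by omega)

theorem entry_glueWith_fractalColumn (k j : ℕ) :
    HMat.entry (HMat.glueWith H H (fractalColumn n)) k j = fractalEntry (n + 1) k j := by
  have hn := fsdmSize_add_one n
  have hpow : 2 ^ (n + 1) = 2 ^ n * 2 := pow_succ 2 n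
  have hM : ((fsdmSize n : ℕ) : ℝ) + 1 = 2 ^ n := by exact_mod_cast hn
  by_cases hin : (1 ≤ k ∧ k ≤ fsdmSize n + 1 + fsdmSize n) ∧
      (1 ≤ j ∧ j ≤ fsdmSize n + 1 + fsdmSize n)
  swap
  · rw [HMat.entry_of_not _ hin]
    simp only [not_and_or, not_le] at hin
    rcases hin with (h | h) | (h | h)
    · rw [show k = 0 by omega, fractalEntry_zero_left]
    · rw [fractalEntry_of_le_left _ (by omega)]
    · rw [show j = 0 by omega, fractalEntry_zero_right]
    · rw [fractalEntry_of_le_right _ (by omega)]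
  obtain ⟨⟨hk, hk'⟩, hj, hj'⟩ := hin
  rw [HMat.glueWith, HMat.entry_ofEntries _ _ hk hk' hj hj', fractalEntry, hn]
  have hhalf : ((fsdmSize n : ℝ) + 1) / ((fsdmSize n : ℝ) + fsdmSize n + 2) = 1 / 2 := by
    rw [show (fsdmSize n : ℝ) + fsdmSize n + 2 = 2 * ((fsdmSize n : ℝ) + 1) by ring]
    have : (fsdmSize n : ℝ) + 1 ≠ 0 := by positivity
    field_simp
  split_ifs with h1 h2 h3 h4 h5 h6 h7 h8
  · exact hH k j
  · rw [HMat.entry_of_not _ (by omega)]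
  · rw [hhalf, sum_Icc_entry_column_eq_fsdmA hH j]
  · rw [mul_div_assoc, hhalf, hM]
    ring
  · rfl
  · rfl
  · simp only [fractalColumn]
    congr 2
    omega
  · omega
  · exact hH _ _

open PowerSeries

/-- A chain of the glued matrix that uses the middle row or column below or left of the diagonal
arises from a nonempty chain of one block by the factor `-1 / 2`, because `a` and `b` are the column
and row sums of `H`. -/
theorem tailSeries_glueWith_fractalColumn :
    HMat.tailSeries (HMat.glueWith H H (fractalColumn n)) 1 =
      HMat.tailSeries H 1 + C ((2 : ℝ) ^ n / 2) * X * HMat.tailSeries H 1 ^ 2 := by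
  have hn := fsdmSize_add_one n
  have hM : ((fsdmSize n : ℕ) : ℝ) + 1 = 2 ^ n := by exact_mod_cast hn
  have hhalf : ((fsdmSize n : ℝ) + 1) / ((fsdmSize n : ℝ) + fsdmSize n + 2) = 1 / 2 := by
    rw [show (fsdmSize n : ℝ) + fsdmSize n + 2 = 2 * ((fsdmSize n : ℝ) + 1) by ring]
    have : (fsdmSize n : ℝ) + 1 ≠ 0 := by positivity
    field_simp
  have hcol : X * ∑ i : Fin (fsdmSize n), C (fractalColumn n i) * HMat.tailSeries H (i + 2) =
      -C (1 / 2 : ℝ) * (HMat.tailSeries H 1 - 1) := by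
    rw [← HMat.X_mul_sum_rowSum_mul_tailSeries, mul_left_comm,
      Finset.mul_sum _ _ (-C (1 / 2 : ℝ))]
    refine congrArg _ ?_
    rw [← Finset.Ico_add_one_right_eq_Icc, Finset.sum_Ico_eq_sum_range, Nat.add_sub_cancel,
      Finset.sum_fin_eq_sum_range]
    refine Finset.sum_congr rfl fun i hi => ?_
    rw [Finset.mem_range] at hi
    rw [dif_pos hi, sum_Icc_entry_row_eq_fsdmB hH (by omega), fractalColumn, map_mul, map_neg,
      mul_assoc, add_comm 1 i]
  have h := HMat.tailSeries_glueWith_leading H H (fractalColumn n) le_rfl (by omega)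
  rw [HMat.tailSeries_glueWith_middle, mul_div_assoc, hhalf, hM, mul_add X, hcol,
    sub_eq_iff_eq_add] at h
  have hC : C (1 / 2 : ℝ) + C (1 / 2 : ℝ) = (1 : PowerSeries ℝ) := by
    rw [← map_add, ← map_one C]
    norm_num
  rw [h, mul_one_div]
  linear_combination (HMat.tailSeries H 1 - HMat.tailSeries H 1 ^ 2) * hC

theorem tailSeries_glueWith_fractalColumn_eq_pow
    (hF : 1 + C ((2 : ℝ) ^ n) * X * HMat.tailSeries H 1 = (1 + X) ^ 2 ^ n) :
    1 + C ((2 : ℝ) ^ (n + 1)) * X *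
        HMat.tailSeries (HMat.glueWith H H (fractalColumn n)) 1 = (1 + X) ^ 2 ^ (n + 1) := by
  have h2 : C ((2 : ℝ) ^ (n + 1)) = 2 * C ((2 : ℝ) ^ n) := by
    rw [pow_succ, mul_comm, map_mul, map_ofNat C 2]
  have h3 : (2 : PowerSeries ℝ) * C ((2 : ℝ) ^ n / 2) = C ((2 : ℝ) ^ n) := by
    rw [← map_ofNat C 2, ← map_mul]
    congr 1
    ring
  rw [show (2 : ℕ) ^ (n + 1) = 2 ^ n * 2 from pow_succ 2 n, pow_mul, ← hF,
    tailSeries_glueWith_fractalColumn hH, h2]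
  linear_combination C ((2 : ℝ) ^ n) * X ^ 2 * HMat.tailSeries H 1 ^ 2 * h3

theorem isGluingColumn_fractalColumn
    (hF : 1 + C ((2 : ℝ) ^ n) * X * HMat.tailSeries H 1 = (1 + X) ^ 2 ^ n) :
    HMat.IsGluingColumn H H (fractalColumn n) := by
  have hn := fsdmSize_add_one n
  have hM : ((fsdmSize n : ℕ) : ℝ) + 1 = 2 ^ n := by exact_mod_cast hn
  intro k hk hk'
  obtain ⟨m, rfl⟩ : ∃ m, k = m + 1 := ⟨k - 1, by omega⟩
  have hrow : ∑ i : Fin (fsdmSize n), fractalColumn n i * HMat.tail H m (i + 2) =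
      -(1 / 2 : ℝ) * HMat.tail H (m + 1) 1 := by
    rw [← HMat.sum_rowSum_mul_tail, Finset.mul_sum, ← Finset.Ico_add_one_right_eq_Icc,
      Finset.sum_Ico_eq_sum_range, Nat.add_sub_cancel, Finset.sum_fin_eq_sum_range]
    refine Finset.sum_congr rfl fun i hi => ?_
    rw [Finset.mem_range] at hi
    rw [dif_pos hi, sum_Icc_entry_row_eq_fsdmB hH (by omega), fractalColumn,
      mul_assoc, add_comm 1 i]
  rw [HMat.Q_glueWith, hrow, Nat.add_sub_cancel]
  have e1 := two_pow_mul_tail_eq_choose hF m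
  have e2 := two_pow_mul_tail_eq_choose hF (m + 1)
  have c1 : ((m : ℝ) + 1) * (Nat.choose (2 ^ n) (m + 1) : ℝ) =
      2 ^ n * (Nat.choose (fsdmSize n) m : ℝ) := by
    have := Nat.add_one_mul_choose_eq (fsdmSize n) m
    rw [hn] at this
    rw [mul_comm]
    exact_mod_cast this.symm
  have c2 : ((m : ℝ) + 2) * (Nat.choose (2 ^ n) (m + 2) : ℝ) =
      (2 ^ n - (m + 1)) * (Nat.choose (2 ^ n) (m + 1) : ℝ) := by
    have := Nat.choose_succ_right_eq (2 ^ n) (m + 1)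
    have h' : (((2 ^ n - (m + 1) : ℕ)) : ℝ) = 2 ^ n - (m + 1) := by
      rw [Nat.cast_sub (by omega)]
      push_cast
      ring
    rw [← h', mul_comm, mul_comm (((2 ^ n - (m + 1) : ℕ)) : ℝ)]
    exact_mod_cast this
  have hN : (0 : ℝ) < 2 ^ n := by positivity
  have hm1 : (m : ℝ) + 1 ≠ 0 := by positivity
  have hm2 : (m : ℝ) + 2 ≠ 0 := by positivity
  have hM' : (fsdmSize n : ℝ) = 2 ^ n - 1 := by linarith
  rw [hM']
  generalize (2 : ℝ) ^ n = N at *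
  generalize HMat.tail H m 1 = p at *
  generalize HMat.tail H (m + 1) 1 = q at *
  generalize ((Nat.choose (fsdmSize n) m : ℕ) : ℝ) = d at *
  generalize ((Nat.choose (2 ^ n) (m + 1) : ℕ) : ℝ) = x at *
  have hx : x = N * d / (m + 1) := by field_simp; linarith
  have hp : p = d / (m + 1) := by
    have : N * p = N * (d / (m + 1)) := by rw [e1, hx]; ring
    exact mul_left_cancel₀ hN.ne' this
  have hq : q = (N - (m + 1)) * d / ((m + 1) * (m + 2)) := by
    have : N * q = N * ((N - (m + 1)) * d / ((m + 1) * (m + 2))) := by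
      rw [e2]
      field_simp
      rw [hx] at c2
      field_simp at c2
      linarith
    exact mul_left_cancel₀ hN.ne' this
  have hN' := hN.ne'
  rw [hp, hq]
  push_cast
  have h4 : N - 1 + (N - 1) + 2 = 2 * N := by ring
  have h5 : (m : ℝ) + 1 + 1 = m + 2 := by ring
  rw [h4, h5]
  field_simp
  ring

end Step

theorem fsdmH_step {n : ℕ} (hH : ∀ k j, HMat.entry (fsdmH n) k j = fractalEntry n k j)
    (hG : HMat.IsGluingColumn (fsdmH n) (fsdmH n) (fractalColumn n)) :
    (∀ c, HMat.IsGluingColumn (fsdmH n) (HMat.dual (fsdmH n)) c ↔ c = fractalColumn n) ∧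
      fsdmH (n + 1) = HMat.glueWith (fsdmH n) (fsdmH n) (fractalColumn n) := by
  have hn := fsdmSize_add_one n
  have huniq : ∀ c, HMat.IsGluingColumn (fsdmH n) (HMat.dual (fsdmH n)) c ↔
      c = fractalColumn n := by
    intro c
    rw [dual_eq_self_of_entry_eq_fractalEntry hH]
    refine ⟨fun hc => hc.unique _ _ (fun i h1 h2 => ?_) hG, fun hc => hc ▸ hG⟩
    rw [hH, fractalEntry_diag (by omega) (by omega)]
    positivity
  refine ⟨huniq, ?_⟩
  have hex : ∃ c, HMat.IsGluingColumn (fsdmH n) (HMat.dual (fsdmH n)) c := ⟨_, (huniq _).2 rfl⟩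
  rw [fsdmH, HMat.glue, dif_pos hex, (huniq _).1 hex.choose_spec,
    dual_eq_self_of_entry_eq_fractalEntry hH]

open PowerSeries in
theorem entry_fsdmH_and_tailSeries (n : ℕ) :
    (∀ k j, HMat.entry (fsdmH n) k j = fractalEntry n k j) ∧
      1 + C ((2 : ℝ) ^ n) * X * HMat.tailSeries (fsdmH n) 1 = (1 + X) ^ 2 ^ n := by
  induction n with
  | zero =>
    refine ⟨fun k j => ?_, ?_⟩
    · rw [HMat.entry_of_not _ (by simp only [fsdmSize]; omega), fractalEntry]
    · have : HMat.tailSeries (fsdmH 0) 1 = 1 := HMat.tailSeries_succ_size (fsdmH 0)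
      simp [this]
  | succ n ih =>
    have hG := isGluingColumn_fractalColumn ih.1 ih.2
    rw [(fsdmH_step ih.1 hG).2]
    exact ⟨entry_glueWith_fractalColumn ih.1, tailSeries_glueWith_fractalColumn_eq_pow ih.1 ih.2⟩

theorem entry_fsdmH (n k j : ℕ) : HMat.entry (fsdmH n) k j = fractalEntry n k j :=
  (entry_fsdmH_and_tailSeries n).1 k j

theorem isGluingColumn_fsdmH_iff (n : ℕ) (c : Fin (fsdmSize n) → ℝ) :
    HMat.IsGluingColumn (fsdmH n) (HMat.dual (fsdmH n)) c ↔ c = fractalColumn n := by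
  obtain ⟨h1, h2⟩ := entry_fsdmH_and_tailSeries n
  exact (fsdmH_step h1 (isGluingColumn_fractalColumn h1 h2)).1 c

/-! ### Updates along the infinite matrix -/

theorem fractalEntry_eq_of_le {n n' k : ℕ} (j : ℕ) (hk : k < 2 ^ n) (hn : n ≤ n') :
    fractalEntry n' k j = fractalEntry n k j := by
  induction n', hn using Nat.le_induction with
  | base => rfl
  | succ n' hn ih =>
    rw [fractalEntry_succ_of_lt j (hk.trans_le (Nat.pow_le_pow_right two_pos hn)), ih]

theorem fsdmB_eq_of_le {n n' k : ℕ} (hk : k < 2 ^ n) (hn : n ≤ n') :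
    fsdmB n' k = fsdmB n k := by
  induction n', hn using Nat.le_induction with
  | base => rfl
  | succ n' hn ih =>
    rw [fsdmB_succ_of_lt (hk.trans_le (Nat.pow_le_pow_right two_pos hn)), ih]

/-- The entries of the infinite matrix that has all the matrices `H^{(n)}` as leading blocks. -/
noncomputable def limitEntry (k j : ℕ) : ℝ := fractalEntry k k j

theorem fractalEntry_eq_limitEntry {n k : ℕ} (j : ℕ) (hk : k < 2 ^ n) :
    fractalEntry n k j = limitEntry k j := by
  rw [limitEntry, ← fractalEntry_eq_of_le j hk (le_max_left n k),
    fractalEntry_eq_of_le j k.lt_two_pow_self (le_max_right n k)]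

/-- The row sums of the infinite matrix that has all the matrices `H^{(n)}` as leading
blocks. -/
noncomputable def limitRowSum (k : ℕ) : ℝ := fsdmB k k

theorem fsdmB_eq_limitRowSum {n k : ℕ} (hk : k < 2 ^ n) : fsdmB n k = limitRowSum k := by
  rw [limitRowSum, ← fsdmB_eq_of_le hk (le_max_left n k),
    fsdmB_eq_of_le k.lt_two_pow_self (le_max_right n k)]

theorem limitRowSum_two_pow (n : ℕ) : limitRowSum (2 ^ n) = ((2 : ℝ) ^ n + 1) / 4 := by
  rw [← fsdmB_succ_two_pow, fsdmB_eq_limitRowSum (by rw [pow_succ]; have := n.two_pow_pos; omega)]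

theorem limitRowSum_two_pow_add {n s : ℕ} (h0 : 0 < s) (h : s < 2 ^ n) :
    limitRowSum (2 ^ n + s) = limitRowSum s / 2 := by
  rw [← fsdmB_eq_limitRowSum h, ← fsdmB_succ_add h0,
    fsdmB_eq_limitRowSum (by rw [pow_succ]; omega)]

section Rows

variable {X : Type*} [AddCommGroup X] [Module ℝ X]

/-- The difference `y_{k-1} - y_k = ∑_{l ≤ k} 2 h_{k,l} g_l` in the `k`-th iteration. -/
noncomputable def rowUpdate (g : ℕ → X) (k : ℕ) : X :=
  ∑ l ∈ Finset.range k, (2 * limitEntry k (l + 1)) • g (l + 1)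

theorem rowUpdate_two_pow (g : ℕ → X) (n : ℕ) :
    rowUpdate g (2 ^ n) = (2 : ℝ) ^ n • g (2 ^ n) -
      ∑ l ∈ Finset.range (2 ^ n - 1), fsdmA n (l + 1) • g (l + 1) := by
  have h0 : 0 < 2 ^ n := by positivity
  have hlt : 2 ^ n < 2 ^ (n + 1) := by rw [pow_succ]; omega
  have hend : rowUpdate g (2 ^ n) = rowUpdate g (2 ^ n - 1 + 1) := by
    rw [Nat.sub_add_cancel h0]
  rw [hend, rowUpdate, Finset.sum_range_succ, Nat.sub_add_cancel h0,
    ← fractalEntry_eq_limitEntry _ hlt, fractalEntry_succ_two_pow_two_pow, add_comm,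
    sub_eq_add_neg, ← Finset.sum_neg_distrib]
  congr 1
  · congr 1
    ring
  · refine Finset.sum_congr rfl fun l hl => ?_
    rw [Finset.mem_range] at hl
    rw [← fractalEntry_eq_limitEntry _ hlt, fractalEntry_succ_two_pow_of_lt (by omega), ← neg_smul]
    congr 1
    ring

theorem rowUpdate_two_pow_add (g : ℕ → X) {n s : ℕ} (h0 : 0 < s) (h : s < 2 ^ n) :
    rowUpdate g (2 ^ n + s) =
      rowUpdate (fun l => g (2 ^ n + l)) s - limitRowSum s • g (2 ^ n) := by
  have hpos : 0 < 2 ^ n := by positivity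
  have hlt : 2 ^ n + s < 2 ^ (n + 1) := by rw [pow_succ]; omega
  have hhead : ∑ l ∈ Finset.range (2 ^ n),
      (2 * limitEntry (2 ^ n + s) (l + 1)) • g (l + 1) = -(limitRowSum s • g (2 ^ n)) := by
    rw [Finset.sum_eq_single_of_mem (2 ^ n - 1) (Finset.mem_range.2 (by omega)),
      Nat.sub_add_cancel hpos, ← fractalEntry_eq_limitEntry _ hlt,
      fractalEntry_succ_add_two_pow h0, fsdmB_eq_limitRowSum h, ← neg_smul]
    · congr 1
      ring
    · intro l hl hne
      rw [Finset.mem_range] at hl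
      rw [← fractalEntry_eq_limitEntry _ hlt, fractalEntry_succ_add_of_lt h0 (by omega), mul_zero,
        zero_smul]
  rw [rowUpdate, Finset.sum_range_add, hhead, neg_add_eq_sub, rowUpdate]
  congr 1
  refine Finset.sum_congr rfl fun l _ => ?_
  rw [← fractalEntry_eq_limitEntry _ hlt, add_assoc, fractalEntry_succ_add_add h0 (by omega),
    fractalEntry_eq_limitEntry _ h]

theorem sum_rowUpdate (g : ℕ → X) (n : ℕ) :
    ∑ s ∈ Finset.range (2 ^ n - 1), rowUpdate g (s + 1) =
      ∑ l ∈ Finset.range (2 ^ n - 1), (2 * fsdmA n (l + 1)) • g (l + 1) := by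
  have h0 : 0 < 2 ^ n := by positivity
  have hrow : ∀ s ∈ Finset.range (2 ^ n - 1), rowUpdate g (s + 1) =
      ∑ l ∈ Finset.range (2 ^ n - 1), (2 * fractalEntry n (s + 1) (l + 1)) • g (l + 1) := by
    intro s hs
    rw [Finset.mem_range] at hs
    rw [rowUpdate]
    refine (Finset.sum_congr rfl fun l _ => ?_).trans
      (Finset.sum_subset (Finset.range_subset_range.2 (by omega)) fun l _ hl => ?_)
    · rw [fractalEntry_eq_limitEntry _ (by omega)]
    · rw [Finset.mem_range] at hl
      rw [fractalEntry_of_lt (by omega), mul_zero, zero_smul]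
  rw [Finset.sum_congr rfl hrow, Finset.sum_comm]
  refine Finset.sum_congr rfl fun l _ => ?_
  rw [← Finset.sum_smul, ← Finset.mul_sum, ← sum_fractalEntry_column, sum_range_eq_head_add _ h0,
    fractalEntry_zero_left, zero_add]

/-- For the vectors `g` of an FSDM sequence `y`, this is
`y_{j-1} - y_j + (y_m - y_{j-1}) / 2`, where `j = m + 2 ^ L`. -/
noncomputable def foldedUpdate (g : ℕ → X) (m L : ℕ) : X :=
  rowUpdate g (m + 2 ^ L) +
    (1 / 2 : ℝ) • ∑ s ∈ Finset.range (2 ^ L - 1), rowUpdate g (m + (s + 1))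

/-- The analogue of `foldedUpdate` for the row sums; it yields the coefficients of the
recurrence. -/
noncomputable def foldedRowSum (m L : ℕ) : ℝ :=
  limitRowSum (m + 2 ^ L) +
    (1 / 2 : ℝ) * ∑ s ∈ Finset.range (2 ^ L - 1), limitRowSum (m + (s + 1))

/-- The entries of the row below a leading block cancel against half the column sums of that
block. -/
theorem foldedUpdate_zero (g : ℕ → X) (L : ℕ) :
    foldedUpdate g 0 L = (2 : ℝ) ^ L • g (2 ^ L) := by
  simp only [foldedUpdate, zero_add]
  rw [rowUpdate_two_pow, sum_rowUpdate, Finset.smul_sum]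
  have hhalf : ∀ l, (1 / 2 : ℝ) • (2 * fsdmA L (l + 1)) • g (l + 1) =
      fsdmA L (l + 1) • g (l + 1) := fun l => by module
  simp only [hhalf]
  abel

theorem foldedRowSum_zero (L : ℕ) : foldedRowSum 0 L = (2 : ℝ) ^ L / 2 := by
  have h0 : 0 < 2 ^ L := by positivity
  have hB := sum_fsdmB L
  rw [sum_range_eq_head_add _ h0, fsdmB_zero_right, zero_add] at hB
  simp only [foldedRowSum, zero_add]
  rw [limitRowSum_two_pow, Finset.sum_congr rfl fun s hs => (fsdmB_eq_limitRowSum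
    (n := L) (by rw [Finset.mem_range] at hs; omega)).symm, hB]
  ring

theorem foldedUpdate_two_pow_add (g : ℕ → X) {n m L : ℕ} (h : m + 2 ^ L < 2 ^ n) :
    foldedUpdate g (2 ^ n + m) L =
      foldedUpdate (fun l => g (2 ^ n + l)) m L - foldedRowSum m L • g (2 ^ n) := by
  have h0 : 0 < 2 ^ L := by positivity
  have hrow : ∀ s ∈ Finset.range (2 ^ L - 1), rowUpdate g (2 ^ n + m + (s + 1)) =
      rowUpdate (fun l => g (2 ^ n + l)) (m + (s + 1)) -
        limitRowSum (m + (s + 1)) • g (2 ^ n) := by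
    intro s hs
    rw [Finset.mem_range] at hs
    rw [add_assoc, rowUpdate_two_pow_add g (by omega) (by omega)]
  rw [foldedUpdate, add_assoc, rowUpdate_two_pow_add g (by omega) h, Finset.sum_congr rfl hrow,
    Finset.sum_sub_distrib, ← Finset.sum_smul, foldedUpdate, foldedRowSum]
  module

theorem foldedRowSum_two_pow_add {n m L : ℕ} (h : m + 2 ^ L < 2 ^ n) :
    foldedRowSum (2 ^ n + m) L = foldedRowSum m L / 2 := by
  have h0 : 0 < 2 ^ L := by positivity
  have hrow : ∀ s ∈ Finset.range (2 ^ L - 1), limitRowSum (2 ^ n + m + (s + 1)) =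
      limitRowSum (m + (s + 1)) / 2 := by
    intro s hs
    rw [Finset.mem_range] at hs
    rw [add_assoc, limitRowSum_two_pow_add (by omega) (by omega)]
  rw [foldedRowSum, add_assoc, limitRowSum_two_pow_add (by omega) h, Finset.sum_congr rfl hrow,
    ← Finset.sum_div, foldedRowSum]
  ring

end Rows

/-! ### Binary expansions and the folded update -/

/-- `i 0 > i 1 > ⋯ > i (p - 1)`. -/
def DecreasingBelow (i : ℕ → ℕ) (p : ℕ) : Prop := ∀ a b, a < b → b < p → i b < i a

/-- The sum `2 ^ i 0 + ⋯ + 2 ^ i (p - 1)`; for decreasing exponents, the number with these binary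
digits. -/
def binarySum (i : ℕ → ℕ) (p : ℕ) : ℕ := ∑ q ∈ Finset.range p, 2 ^ i q

theorem DecreasingBelow.tail {i : ℕ → ℕ} {p : ℕ} (h : DecreasingBelow i (p + 1)) :
    DecreasingBelow (fun q => i (q + 1)) p :=
  fun a b hab hb => h (a + 1) (b + 1) (by omega) (by omega)

theorem binarySum_succ' (i : ℕ → ℕ) (p : ℕ) :
    binarySum i (p + 1) = 2 ^ i 0 + binarySum (fun q => i (q + 1)) p := by
  rw [binarySum, Finset.sum_range_succ', add_comm]
  rfl

theorem binarySum_add_two_pow_le {i : ℕ → ℕ} {p L k : ℕ} (h : DecreasingBelow i p)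
    (hL : ∀ q < p, L ≤ i q) (hk : ∀ q < p, i q < k) (hLk : L ≤ k) :
    binarySum i p + 2 ^ L ≤ 2 ^ k := by
  induction p generalizing i k with
  | zero => simpa [binarySum] using Nat.pow_le_pow_right two_pos hLk
  | succ p ih =>
    have h1 := ih h.tail (fun q hq => hL _ (by omega)) (k := i 0)
      (fun q hq => h 0 (q + 1) (by omega) (by omega)) (hL 0 (by omega))
    have h2 : 2 ^ (i 0 + 1) ≤ 2 ^ k := Nat.pow_le_pow_right two_pos (hk 0 (by omega))
    rw [pow_succ] at h2
    rw [binarySum_succ']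
    omega

theorem binarySum_add_two_pow_lt {i : ℕ → ℕ} {p L k : ℕ} (h : DecreasingBelow i p)
    (hL : ∀ q < p, L < i q) (hk : ∀ q < p, i q < k) (hLk : L < k) :
    binarySum i p + 2 ^ L < 2 ^ k := by
  have h1 := binarySum_add_two_pow_le (L := L + 1) h hL hk hLk
  have h2 : 0 < 2 ^ L := by positivity
  rw [pow_succ] at h1
  omega

theorem foldedRowSum_binarySum {i : ℕ → ℕ} {p L : ℕ} (h : DecreasingBelow i p)
    (hL : ∀ q < p, L < i q) : foldedRowSum (binarySum i p) L = (2 : ℝ) ^ L / 2 ^ (p + 1) := by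
  induction p generalizing i with
  | zero => simpa [binarySum] using foldedRowSum_zero L
  | succ p ih =>
    rw [binarySum_succ', foldedRowSum_two_pow_add, ih h.tail fun q hq => hL _ (by omega)]
    · rw [pow_succ 2 (p + 1)]
      ring
    · exact binarySum_add_two_pow_lt h.tail (fun q hq => hL _ (by omega))
        (fun q hq => h 0 (q + 1) (by omega) (by omega)) (hL 0 (by omega))

/-- The folded update at `m + 2 ^ L` only involves the vectors `g` at `m + 2 ^ L` and at the
prefixes of the binary expansion of `m`. -/
theorem foldedUpdate_binarySum {X : Type*} [AddCommGroup X] [Module ℝ X] (g : ℕ → X)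
    {i : ℕ → ℕ} {p L : ℕ} (h : DecreasingBelow i p) (hL : ∀ q < p, L < i q) :
    foldedUpdate g (binarySum i p) L = (2 : ℝ) ^ L • g (binarySum i p + 2 ^ L) -
      ∑ q ∈ Finset.range p, ((2 : ℝ) ^ L / 2 ^ (p - q)) • g (binarySum i (q + 1)) := by
  induction p generalizing i g with
  | zero => simpa [binarySum] using foldedUpdate_zero g L
  | succ p ih =>
    have hL' : ∀ q < p, L < i (q + 1) := fun q hq => hL _ (by omega)
    rw [Finset.sum_range_succ', binarySum_succ' i p, foldedUpdate_two_pow_add g, ih _ h.tail hL',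
      foldedRowSum_binarySum h.tail hL']
    · have hshift : ∀ q, 2 ^ i 0 + binarySum (fun q => i (q + 1)) (q + 1) =
          binarySum i (q + 1 + 1) := fun q => (binarySum_succ' i (q + 1)).symm
      have hone : binarySum i (0 + 1) = 2 ^ i 0 := by simp [binarySum]
      simp only [hshift, hone, Nat.add_sub_add_right, Nat.sub_zero, add_assoc, sub_sub]
    · exact binarySum_add_two_pow_lt h.tail hL'
        (fun q hq => h 0 (q + 1) (by omega) (by omega)) (hL 0 (by omega))

theorem le_of_two_pow_dvd_binarySum {i : ℕ → ℕ} {p k : ℕ} (h : DecreasingBelow i p)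
    (hd : 2 ^ k ∣ binarySum i p) : ∀ q < p, k ≤ i q := by
  cases p with
  | zero => simp
  | succ p =>
    suffices hp : k ≤ i p by
      intro q hq
      rcases (Nat.lt_succ_iff.1 hq).eq_or_lt with rfl | hlt
      · exact hp
      · exact hp.trans (h q p hlt (by omega)).le
    by_contra! hlt
    -- all digits before the last one are divisible by a higher power of two
    have h1 : 2 ^ (i p + 1) ∣ binarySum i p :=
      Finset.dvd_sum fun q hq => pow_dvd_pow 2 (h q p (Finset.mem_range.1 hq) (by omega))
    have h2 : 2 ^ (i p + 1) ∣ binarySum i p + 2 ^ i p := by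
      have := (pow_dvd_pow 2 hlt : 2 ^ (i p + 1) ∣ 2 ^ k).trans hd
      rwa [binarySum, Finset.sum_range_succ] at this
    have h3 := Nat.le_of_dvd (by positivity) ((Nat.dvd_add_right h1).1 h2)
    rw [pow_succ] at h3
    have : 0 < 2 ^ i p := by positivity
    omega

theorem exists_binarySum_eq (m : ℕ) : ∃ p i, DecreasingBelow i p ∧ binarySum i p = m := by
  induction m using Nat.strong_induction_on with
  | _ m ih =>
    rcases Nat.eq_zero_or_pos m with rfl | hm
    · exact ⟨0, id, fun a b _ hb => by omega, rfl⟩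
    obtain ⟨p, i, hi, hsum⟩ := ih (m / 2) (by omega)
    have hdouble : ∑ q ∈ Finset.range p, 2 ^ (i q + 1) = 2 * (m / 2) := by
      rw [← hsum, binarySum, Finset.mul_sum]
      exact Finset.sum_congr rfl fun q _ => by rw [pow_succ, mul_comm]
    rcases Nat.mod_two_eq_zero_or_one m with h | h
    · refine ⟨p, fun q => i q + 1, fun a b hab hb => Nat.succ_lt_succ (hi a b hab hb), ?_⟩
      rw [binarySum, hdouble]
      omega
    · refine ⟨p + 1, fun q => if q < p then i q + 1 else 0, fun a b hab hb => ?_, ?_⟩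
      · dsimp only
        rw [if_pos (by omega : a < p)]
        split_ifs with hbp
        · exact Nat.succ_lt_succ (hi a b hab hbp)
        · omega
      · rw [binarySum, Finset.sum_range_succ, if_neg (lt_irrefl p), Finset.sum_congr rfl fun q hq =>
          by rw [if_pos (Finset.mem_range.1 hq)], hdouble, pow_zero]
        omega

theorem fsdmM_add_two_pow {j : ℕ} (hj : 1 ≤ j) : fsdmM j + 2 ^ padicValNat 2 j = j :=
  Nat.sub_add_cancel (Nat.le_of_dvd hj pow_padicValNat_dvd)

theorem two_pow_succ_dvd_fsdmM {j : ℕ} (hj : 1 ≤ j) :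
    2 ^ (padicValNat 2 j + 1) ∣ fsdmM j := by
  obtain ⟨c, hc⟩ : 2 ^ padicValNat 2 j ∣ j := pow_padicValNat_dvd
  have hodd : ¬ 2 ∣ c := by
    rintro ⟨d, rfl⟩
    refine pow_succ_padicValNat_not_dvd (p := 2) (by omega : j ≠ 0) ⟨d, ?_⟩
    rw [pow_succ, mul_assoc]
    exact hc
  refine ⟨c / 2, ?_⟩
  have h2 : c = 2 * (c / 2) + 1 := by omega
  have h3 := fsdmM_add_two_pow hj
  have h4 : 2 ^ padicValNat 2 j * c = 2 ^ (padicValNat 2 j + 1) * (c / 2) +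
      2 ^ padicValNat 2 j := by
    conv_lhs => rw [h2]
    rw [pow_succ]
    ring
  omega

/-! ### The iterates of FSDM -/

section Iterates

variable {X : Type u} [NormedAddCommGroup X] [InnerProductSpace ℝ X] {T : X → X}

/-- All the methods with matrices `H^{(n)}` are truncations of one method, whose matrix is the
infinite one. -/
theorem isFSDM_iff (y : ℕ → X) :
    IsFSDM T y ↔ ∀ k, y (k + 1) = y k - rowUpdate (fsdmG T y) (k + 1) := by
  have hrow : ∀ n k, k < fsdmSize n →
      ∑ j ∈ Finset.range (k + 1), HMat.entry (fsdmH n) (k + 1) (j + 1) • (y j - T (y j)) =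
        rowUpdate (fsdmG T y) (k + 1) := by
    intro n k hk
    have hn := fsdmSize_add_one n
    refine Finset.sum_congr rfl fun j _ => ?_
    rw [entry_fsdmH, fractalEntry_eq_limitEntry _ (by omega), fsdmG, smul_smul,
      Nat.add_sub_cancel]
    congr 1
    ring
  constructor
  · intro h k
    have hk : k < fsdmSize (k + 1) := by
      have := fsdmSize_add_one (k + 1)
      have := (k + 1).lt_two_pow_self
      omega
    rw [h (k + 1) k hk, hrow _ _ hk]
  · intro h n k hk
    rw [h k, hrow _ _ hk]

/-- The first `k` iterates of FSDM, extended step by step; beyond the index `k` the value is the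
placeholder `y₀`. -/
noncomputable def fsdmPrefix (T : X → X) (y₀ : X) : ℕ → ℕ → X
  | 0 => fun _ => y₀
  | k + 1 => Function.update (fsdmPrefix T y₀ k) (k + 1)
      (fsdmPrefix T y₀ k k - rowUpdate (fsdmG T (fsdmPrefix T y₀ k)) (k + 1))

theorem rowUpdate_fsdmG_congr {y z : ℕ → X} {k : ℕ} (h : ∀ l < k, y l = z l) :
    rowUpdate (fsdmG T y) k = rowUpdate (fsdmG T z) k := by
  refine Finset.sum_congr rfl fun l hl => ?_
  rw [fsdmG, fsdmG, Nat.add_sub_cancel, h l (Finset.mem_range.1 hl)]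

theorem fsdmPrefix_eq_of_le (y₀ : X) {l k : ℕ} (h : l ≤ k) :
    fsdmPrefix T y₀ k l = fsdmPrefix T y₀ l l := by
  induction k, h using Nat.le_induction with
  | base => rfl
  | succ k h ih => rw [fsdmPrefix, Function.update_of_ne (by omega), ih]

theorem existsUnique_isFSDM (T : X → X) (y₀ : X) : ∃! y : ℕ → X, y 0 = y₀ ∧ IsFSDM T y := by
  refine ⟨fun k => fsdmPrefix T y₀ k k, ⟨rfl, (isFSDM_iff _).2 fun k => ?_⟩, ?_⟩
  · rw [fsdmPrefix, Function.update_self]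
    congr 1
    exact rowUpdate_fsdmG_congr fun l hl => fsdmPrefix_eq_of_le y₀ (by omega)
  · rintro z ⟨hz0, hz⟩
    rw [isFSDM_iff] at hz
    funext k
    induction k using Nat.strong_induction_on with
    | _ k ih =>
      cases k with
      | zero => exact hz0
      | succ k =>
        rw [hz k, fsdmPrefix, Function.update_self, ih k (by omega)]
        congr 1
        refine rowUpdate_fsdmG_congr fun l hl => ?_
        rw [ih l hl, fsdmPrefix_eq_of_le y₀ (by omega : l ≤ k)]

theorem IsFSDM.sub_eq_sum {y : ℕ → X} (hy : IsFSDM T y) (m s : ℕ) :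
    y m - y (m + s) = ∑ l ∈ Finset.range s, rowUpdate (fsdmG T y) (m + (l + 1)) := by
  induction s with
  | zero => simp
  | succ s ih =>
    rw [Finset.sum_range_succ, ← ih, ← add_assoc, (isFSDM_iff y).1 hy]
    abel

theorem IsFSDM.recurrence {y : ℕ → X} (hy : IsFSDM T y) {j p : ℕ} {i : ℕ → ℕ} (hj : 1 ≤ j)
    (hi : DecreasingBelow i p) (hm : binarySum i p = fsdmM j) :
    y j = y (j - 1) - (2 : ℝ) ^ padicValNat 2 j • fsdmG T y j
      + (1 / 2 : ℝ) • (y (fsdmM j) - y (j - 1))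
      + ∑ q ∈ Finset.range p, ((2 : ℝ) ^ padicValNat 2 j / 2 ^ (p - q)) •
          fsdmG T y (binarySum i (q + 1)) := by
  set L := padicValNat 2 j with hLdef
  have hjm : fsdmM j + 2 ^ L = j := fsdmM_add_two_pow hj
  have hpos : 0 < 2 ^ L := by positivity
  have hL : ∀ q < p, L < i q := le_of_two_pow_dvd_binarySum hi (hm ▸ two_pow_succ_dvd_fsdmM hj)
  have h1 := foldedUpdate_binarySum (fsdmG T y) hi hL
  rw [hm, foldedUpdate, ← hy.sub_eq_sum, hjm,
    show fsdmM j + (2 ^ L - 1) = j - 1 by omega] at h1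
  have h2 := (isFSDM_iff y).1 hy (j - 1)
  rw [Nat.sub_add_cancel hj] at h2
  rw [h2, eq_sub_of_add_eq h1]
  abel

end Iterates

/-! ### The register program -/

/-- The exponents of the binary expansion of `fsdmM j`, in decreasing order. -/
noncomputable def fsdmExponent (j : ℕ) : ℕ → ℕ := (exists_binarySum_eq (fsdmM j)).choose_spec.choose

/-- The number of binary digits `1` of `fsdmM j`. -/
noncomputable def fsdmDigitCount (j : ℕ) : ℕ := (exists_binarySum_eq (fsdmM j)).choose

theorem decreasingBelow_fsdmExponent (j : ℕ) :
    DecreasingBelow (fsdmExponent j) (fsdmDigitCount j) :=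
  (exists_binarySum_eq (fsdmM j)).choose_spec.choose_spec.1

theorem binarySum_fsdmExponent (j : ℕ) :
    binarySum (fsdmExponent j) (fsdmDigitCount j) = fsdmM j :=
  (exists_binarySum_eq (fsdmM j)).choose_spec.choose_spec.2

theorem padicValNat_lt_fsdmExponent {j q : ℕ} (hj : 1 ≤ j) (hq : q < fsdmDigitCount j) :
    padicValNat 2 j < fsdmExponent j q :=
  le_of_two_pow_dvd_binarySum (decreasingBelow_fsdmExponent j)
    (binarySum_fsdmExponent j ▸ two_pow_succ_dvd_fsdmM hj) q hq

theorem fsdmExponent_le_log {j q : ℕ} (hq : q < fsdmDigitCount j) :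
    fsdmExponent j q ≤ Nat.log 2 j := by
  have h : 2 ^ fsdmExponent j q ≤ binarySum (fsdmExponent j) (fsdmDigitCount j) :=
    Finset.single_le_sum (f := fun q => 2 ^ fsdmExponent j q) (fun _ _ => Nat.zero_le _)
      (Finset.mem_range.2 hq)
  rw [binarySum_fsdmExponent] at h
  have h' : 2 ^ fsdmExponent j q ≤ j := h.trans (Nat.sub_le _ _)
  exact Nat.le_log_of_pow_le one_lt_two h'

/-- The register that holds `y_{m(j)}` during the `j`-th iteration. -/
noncomputable def anchorRegister (j : ℕ) : ℕ :=
  if fsdmDigitCount j = 0 then 3 else 4 + 2 * fsdmExponent j (fsdmDigitCount j - 1)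

/-- The instructions that add the terms of the recurrence with earlier vectors `g_t`. -/
noncomputable def memoryTerms (j p : ℕ) : List VecInstr :=
  (List.range p).map fun q => .comb 0 1 0
    ((2 : ℝ) ^ padicValNat 2 j / 2 ^ (fsdmDigitCount j - q)) (5 + 2 * fsdmExponent j q)

/-- The program of the `j`-th iteration. Register `0` holds the current iterate, register `1` the
current `g`, register `3` the starting point (saved in the first iteration; register `2` is
unused), and the registers `4 + 2 e` and `5 + 2 e` hold `y_t` and `g_t` for the prefix `t` of the
binary expansion of the iteration count that ends at the digit of `2 ^ e`. -/
noncomputable def fsdmProgram (j : ℕ) : List VecInstr :=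
  [.comb 3 (if j = 1 then 1 else 0) 0 (if j = 1 then 0 else 1) 3,
    .query 1 0,
    .comb 1 (1 / 2) 0 (-(1 / 2)) 1,
    .comb 0 (1 / 2) 0 (1 / 2) (anchorRegister j),
    .comb 0 1 0 (-(2 : ℝ) ^ padicValNat 2 j) 1] ++
  (memoryTerms j (fsdmDigitCount j) ++
  [.comb (4 + 2 * padicValNat 2 j) 1 0 0 0,
    .comb (5 + 2 * padicValNat 2 j) 1 1 0 1])

theorem countP_isQuery_fsdmProgram (j : ℕ) : (fsdmProgram j).countP VecInstr.isQuery = 1 := by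
  have h : (memoryTerms j (fsdmDigitCount j)).countP VecInstr.isQuery = 0 := by
    rw [List.countP_eq_zero]
    intro I hI
    obtain ⟨q, -, rfl⟩ := List.mem_map.1 hI
    simp [VecInstr.isQuery]
  simp [fsdmProgram, List.countP_cons, h, VecInstr.isQuery]

theorem regs_fsdmProgram_lt {N j : ℕ} (hj : 1 ≤ j) (hjN : j ≤ N) {I : VecInstr}
    (hI : I ∈ fsdmProgram j) {r : ℕ} (hr : r ∈ I.regs) : r < 2 * Nat.log 2 N + 6 := by
  have hlog : Nat.log 2 j ≤ Nat.log 2 N := Nat.log_mono_right hjN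
  have hval : padicValNat 2 j ≤ Nat.log 2 j :=
    Nat.le_log_of_pow_le one_lt_two (Nat.le_of_dvd hj pow_padicValNat_dvd)
  have hanchor : anchorRegister j < 2 * Nat.log 2 N + 6 := by
    rw [anchorRegister]
    split_ifs with h
    · omega
    · have := fsdmExponent_le_log (j := j) (q := fsdmDigitCount j - 1) (by omega)
      omega
  rw [fsdmProgram, List.mem_append, List.mem_append] at hI
  rcases hI with hI | hI | hI
  · simp only [List.mem_cons, List.not_mem_nil, or_false] at hI
    rcases hI with rfl | rfl | rfl | rfl | rfl <;>
      simp only [VecInstr.regs, Finset.mem_insert, Finset.mem_singleton] at hr <;> omega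
  · obtain ⟨q, hq, rfl⟩ := List.mem_map.1 hI
    have := fsdmExponent_le_log (List.mem_range.1 hq)
    simp only [VecInstr.regs, Finset.mem_insert, Finset.mem_singleton] at hr
    omega
  · simp only [List.mem_cons, List.not_mem_nil, or_false] at hI
    rcases hI with rfl | rfl <;>
      simp only [VecInstr.regs, Finset.mem_insert, Finset.mem_singleton] at hr <;> omega

section Execution

variable {X : Type u} [NormedAddCommGroup X] [InnerProductSpace ℝ X] {T : X → X}

theorem foldl_exec_memoryTerms (R : ℕ → X) (j p : ℕ) :
    (memoryTerms j p).foldl (VecInstr.exec T) R = Function.update R 0 (R 0 +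
      ∑ q ∈ Finset.range p, ((2 : ℝ) ^ padicValNat 2 j / 2 ^ (fsdmDigitCount j - q)) •
        R (5 + 2 * fsdmExponent j q)) := by
  induction p with
  | zero => simp [memoryTerms]
  | succ p ih =>
    have hne : 5 + 2 * fsdmExponent j p ≠ 0 := by omega
    have hsplit : memoryTerms j (p + 1) = memoryTerms j p ++ [.comb 0 1 0
        ((2 : ℝ) ^ padicValNat 2 j / 2 ^ (fsdmDigitCount j - p)) (5 + 2 * fsdmExponent j p)] := by
      simp [memoryTerms, List.range_succ]
    rw [hsplit, List.foldl_append, ih, List.foldl_cons, List.foldl_nil, VecInstr.exec,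
      Function.update_idem, Function.update_self, Function.update_of_ne hne, one_smul,
      Finset.sum_range_succ, add_assoc]

/-- The contents of the registers after `j` iterations. The hypotheses on `t = (2 s + 1) 2 ^ e` say
that `t` is the prefix of the binary expansion of `j` that ends at the digit of `2 ^ e`, and that
this digit is `1`. -/
structure RegisterInvariant (T : X → X) (y : ℕ → X) (j : ℕ) (R : ℕ → X) : Prop where
  current : R 0 = y j
  start : 1 ≤ j → R 3 = y 0
  point : ∀ e s, (2 * s + 1) * 2 ^ e ≤ j → j < (2 * s + 1) * 2 ^ e + 2 ^ e →
    R (4 + 2 * e) = y ((2 * s + 1) * 2 ^ e)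
  residual : ∀ e s, (2 * s + 1) * 2 ^ e ≤ j → j < (2 * s + 1) * 2 ^ e + 2 ^ e →
    R (5 + 2 * e) = fsdmG T y ((2 * s + 1) * 2 ^ e)


theorem exists_prefix_eq {i : ℕ → ℕ} {p q : ℕ} (h : DecreasingBelow i p) (hq : q < p) :
    ∃ s, binarySum i (q + 1) = (2 * s + 1) * 2 ^ i q := by
  have hd : 2 ^ (i q + 1) ∣ binarySum i q :=
    Finset.dvd_sum fun a ha => pow_dvd_pow 2 (h a q (Finset.mem_range.1 ha) hq)
  obtain ⟨s, hs⟩ := hd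
  refine ⟨s, ?_⟩
  rw [binarySum, Finset.sum_range_succ]
  change binarySum i q + 2 ^ i q = _
  rw [hs, pow_succ]
  ring

theorem binarySum_prefix_le (i : ℕ → ℕ) {p q : ℕ} (h : q ≤ p) :
    binarySum i q ≤ binarySum i p :=
  Finset.sum_le_sum_of_subset (Finset.range_subset_range.2 h)

theorem binarySum_add_two_pow_le_binarySum {i : ℕ → ℕ} {p q L : ℕ} (h : DecreasingBelow i p)
    (hL : ∀ q < p, L ≤ i q) (hq : q < p) :
    binarySum i p + 2 ^ L ≤ binarySum i (q + 1) + 2 ^ i q := by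
  have hsplit : binarySum i p =
      binarySum i (q + 1) + binarySum (fun a => i (q + 1 + a)) (p - (q + 1)) := by
    rw [binarySum, binarySum, binarySum, ← Finset.sum_range_add, Nat.add_sub_cancel' hq]
  have := binarySum_add_two_pow_le (i := fun a => i (q + 1 + a)) (p := p - (q + 1)) (L := L)
    (k := i q) (fun a b hab hb => h _ _ (by omega) (by omega)) (fun a ha => hL _ (by omega))
    (fun a ha => h _ _ (by omega) (by omega)) (hL q hq)
  omega

theorem RegisterInvariant.prefix_eq {y : ℕ → X} {j : ℕ} {R : ℕ → X}
    (hR : RegisterInvariant T y j R) {q : ℕ} (hq : q < fsdmDigitCount (j + 1)) :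
    R (4 + 2 * fsdmExponent (j + 1) q) = y (binarySum (fsdmExponent (j + 1)) (q + 1)) ∧
      R (5 + 2 * fsdmExponent (j + 1) q) =
        fsdmG T y (binarySum (fsdmExponent (j + 1)) (q + 1)) := by
  have hdec := decreasingBelow_fsdmExponent (j + 1)
  have hm := fsdmM_add_two_pow (j := j + 1) (by omega)
  have hpos : 0 < 2 ^ padicValNat 2 (j + 1) := by positivity
  have hle := binarySum_prefix_le (fsdmExponent (j + 1)) (Nat.succ_le_of_lt hq)
  have hlt := binarySum_add_two_pow_le_binarySum hdec
    (fun q hq => (padicValNat_lt_fsdmExponent (by omega) hq).le) hq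
  rw [binarySum_fsdmExponent] at hle hlt
  obtain ⟨s, hs⟩ := exists_prefix_eq hdec hq
  rw [Nat.succ_eq_add_one] at hle
  rw [hs] at hle hlt ⊢
  exact ⟨hR.point _ s (by omega) (by omega), hR.residual _ s (by omega) (by omega)⟩

theorem three_le_anchorRegister (j : ℕ) : 3 ≤ anchorRegister j := by
  rw [anchorRegister]
  split_ifs <;> omega

theorem RegisterInvariant.anchor_eq {y : ℕ → X} {j : ℕ} {R R' : ℕ → X}
    (hR : RegisterInvariant T y j R) (h3 : R' 3 = y 0) (h4 : ∀ r, 4 ≤ r → R' r = R r) :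
    R' (anchorRegister (j + 1)) = y (fsdmM (j + 1)) := by
  rw [← binarySum_fsdmExponent, anchorRegister]
  split_ifs with h
  · rw [h3, h]
    rfl
  · rw [h4 _ (by omega), (hR.prefix_eq (q := fsdmDigitCount (j + 1) - 1) (by omega)).1,
      Nat.sub_add_cancel (by omega)]

theorem foldl_exec_fsdmProgram (R : ℕ → X) (j : ℕ) :
    ∃ A : ℕ → X, (A 3 = if j = 1 then R 0 else R 3) ∧ (∀ r, 4 ≤ r → A r = R r) ∧
      A 1 = (1 / 2 : ℝ) • (R 0 - T (R 0)) ∧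
      A 0 = (1 / 2 : ℝ) • R 0 + (1 / 2 : ℝ) • A (anchorRegister j) -
        (2 : ℝ) ^ padicValNat 2 j • A 1 +
        ∑ q ∈ Finset.range (fsdmDigitCount j),
          ((2 : ℝ) ^ padicValNat 2 j / 2 ^ (fsdmDigitCount j - q)) •
            A (5 + 2 * fsdmExponent j q) ∧
      (fsdmProgram j).foldl (VecInstr.exec T) R = Function.update
        (Function.update A (4 + 2 * padicValNat 2 j) (A 0)) (5 + 2 * padicValNat 2 j) (A 1) := by
  have ha := three_le_anchorRegister j
  have hsave : (if j = 1 then (1 : ℝ) else 0) • R 0 + (if j = 1 then (0 : ℝ) else 1) • R 3 =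
      if j = 1 then R 0 else R 3 := by
    split_ifs <;> simp
  set S : ℕ → X := Function.update R 3 (if j = 1 then R 0 else R 3) with hS
  set g : X := (1 / 2 : ℝ) • (R 0 - T (R 0)) with hg
  set v : X := (1 / 2 : ℝ) • R 0 + (1 / 2 : ℝ) • S (anchorRegister j) -
    (2 : ℝ) ^ padicValNat 2 j • g with hv
  have hhead : ([.comb 3 (if j = 1 then 1 else 0) 0 (if j = 1 then 0 else 1) 3,
      .query 1 0, .comb 1 (1 / 2) 0 (-(1 / 2)) 1,
      .comb 0 (1 / 2) 0 (1 / 2) (anchorRegister j),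
      .comb 0 1 0 (-(2 : ℝ) ^ padicValNat 2 j) 1] : List VecInstr).foldl (VecInstr.exec T) R =
      Function.update (Function.update S 1 g) 0 v := by
    have ha0 : anchorRegister j ≠ 0 := by omega
    have ha1 : anchorRegister j ≠ 1 := by omega
    have h0 : S 0 = R 0 := Function.update_of_ne (by omega) _ _
    have hg' : (1 / 2 : ℝ) • R 0 + (-(1 / 2) : ℝ) • T (R 0) = g := by
      rw [hg]
      module
    simp only [List.foldl_cons, List.foldl_nil, VecInstr.exec, hsave, ← hS, h0,
      Function.update_self, Function.update_idem, Function.update_of_ne (zero_ne_one' ℕ), hg',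
      Function.update_of_ne ha1, Function.update_of_ne (one_ne_zero' ℕ)]
    congr 1
    rw [hv]
    module
  set w : X := v + ∑ q ∈ Finset.range (fsdmDigitCount j),
    ((2 : ℝ) ^ padicValNat 2 j / 2 ^ (fsdmDigitCount j - q)) • S (5 + 2 * fsdmExponent j q)
    with hw
  have hge : ∀ (u : X) r, 2 ≤ r → Function.update (Function.update S 1 g) 0 u r = S r := by
    intro u r hr
    rw [Function.update_of_ne (by omega), Function.update_of_ne (by omega)]
  have hone : ∀ u : X, Function.update (Function.update S 1 g) 0 u 1 = g := by
    intro u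
    rw [Function.update_of_ne one_ne_zero, Function.update_self]
  refine ⟨Function.update (Function.update S 1 g) 0 w, ?_, ?_, hone w, ?_, ?_⟩
  · rw [hge _ _ (by omega), hS, Function.update_self]
  · intro r hr
    rw [hge _ _ (by omega), hS, Function.update_of_ne (by omega)]
  · rw [Function.update_self, hone, hge _ _ (by omega), hw, hv]
    congr 1
    exact Finset.sum_congr rfl fun q _ => by rw [hge _ _ (by omega)]
  · rw [fsdmProgram, List.foldl_append, List.foldl_append, hhead, foldl_exec_memoryTerms,
      Function.update_idem, Function.update_self,
      Finset.sum_congr rfl fun q _ => by rw [hge v (5 + 2 * fsdmExponent j q) (by omega)], ← hw]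
    simp only [List.foldl_cons, List.foldl_nil, VecInstr.exec, one_smul, zero_smul, add_zero]
    rw [Function.update_of_ne (by omega : 1 ≠ 4 + 2 * padicValNat 2 j)]

/-- The last digit `2 ^ L` of the iteration count `j + 1` replaces all the lower digits of `j`, and
the higher digits of both agree, so only the two registers of the digit `2 ^ L` change. -/
theorem RegisterInvariant.step {y : ℕ → X} (hy : IsFSDM T y) {j : ℕ} {R : ℕ → X}
    (hR : RegisterInvariant T y j R) :
    RegisterInvariant T y (j + 1) ((fsdmProgram (j + 1)).foldl (VecInstr.exec T) R) := by
  obtain ⟨A, h3, h4, h1, h0, hfold⟩ := foldl_exec_fsdmProgram (T := T) R (j + 1)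
  have h3' : A 3 = y 0 := by
    rw [h3]
    split_ifs with h
    · rw [hR.current, show j = 0 by omega]
    · exact hR.start (by omega)
  have h1' : A 1 = fsdmG T y (j + 1) := by
    rw [h1, hR.current, fsdmG, Nat.add_sub_cancel]
  have h0' : A 0 = y (j + 1) := by
    rw [h0, hR.anchor_eq h3' h4, h1', hR.current, hy.recurrence (by omega)
      (decreasingBelow_fsdmExponent (j + 1)) (binarySum_fsdmExponent (j + 1)),
      Nat.add_sub_cancel, Finset.sum_congr rfl fun q hq => by
        rw [h4 _ (by omega), (hR.prefix_eq (Finset.mem_range.1 hq)).2]]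
    module
  have hother : ∀ e s, e ≠ padicValNat 2 (j + 1) → (2 * s + 1) * 2 ^ e ≤ j + 1 →
      j + 1 < (2 * s + 1) * 2 ^ e + 2 ^ e → (2 * s + 1) * 2 ^ e ≤ j := by
    intro e s he h5 h6
    refine Nat.le_of_lt_succ (lt_of_le_of_ne h5 fun heq => he ?_)
    rw [Nat.succ_eq_add_one] at heq
    rw [← heq, padicValNat.mul (by omega) (by positivity), padicValNat.prime_pow,
      padicValNat.eq_zero_of_not_dvd (by omega), zero_add]
  have hsame : ∀ s, (2 * s + 1) * 2 ^ padicValNat 2 (j + 1) ≤ j + 1 →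
      j + 1 < (2 * s + 1) * 2 ^ padicValNat 2 (j + 1) + 2 ^ padicValNat 2 (j + 1) →
      (2 * s + 1) * 2 ^ padicValNat 2 (j + 1) = j + 1 := by
    intro s h5 h6
    obtain ⟨d, hd⟩ : 2 ^ padicValNat 2 (j + 1) ∣ j + 1 := pow_padicValNat_dvd
    generalize 2 ^ padicValNat 2 (j + 1) = P at *
    rw [mul_comm] at h5 h6 ⊢
    rw [hd] at h5 h6 ⊢
    have hP : 0 < P := Nat.pos_of_ne_zero (by rintro rfl; omega)
    have h7 := Nat.le_of_mul_le_mul_left h5 hP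
    have h8 : d < 2 * s + 1 + 1 := Nat.lt_of_mul_lt_mul_left (a := P) (by rw [mul_add P]; omega)
    rw [show d = 2 * s + 1 by omega]
  rw [hfold]
  constructor
  · rw [Function.update_of_ne (by omega), Function.update_of_ne (by omega), h0']
  · intro _
    rw [Function.update_of_ne (by omega), Function.update_of_ne (by omega), h3']
  · intro e s h5 h6
    rw [Function.update_of_ne (by omega)]
    by_cases he : e = padicValNat 2 (j + 1)
    · subst he
      rw [Function.update_self, h0', hsame s h5 h6]
    · rw [Function.update_of_ne (by omega), h4 _ (by omega),
        hR.point e s (hother e s he h5 h6) (by omega)]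
  · intro e s h5 h6
    by_cases he : e = padicValNat 2 (j + 1)
    · subst he
      rw [Function.update_self, h1', hsame s h5 h6]
    · rw [Function.update_of_ne (by omega), Function.update_of_ne (by omega), h4 _ (by omega),
        hR.residual e s (hother e s he h5 h6) (by omega)]

theorem registerInvariant_runIterations {y : ℕ → X} (hy : IsFSDM T y) {R : ℕ → X}
    (hR : R 0 = y 0) (j : ℕ) : RegisterInvariant T y j (runIterations T fsdmProgram R j) := by
  induction j with
  | zero =>
    have hne : ∀ e s : ℕ, ¬ (2 * s + 1) * 2 ^ e ≤ 0 := fun e s h => by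
      have : 0 < (2 * s + 1) * 2 ^ e := by positivity
      omega
    exact ⟨hR, fun h => by omega, fun e s h => absurd h (hne e s), fun e s h => absurd h (hne e s)⟩
  | succ j ih => exact ih.step hy

end Execution

/-! ### The statements for FSDM -/

theorem sum_Icc_one_eq_sum_range {A : Type*} [AddCommMonoid A] (f : ℕ → A) (r : ℕ) :
    ∑ q ∈ Finset.Icc 1 r, f q = ∑ q ∈ Finset.range r, f (q + 1) := by
  rw [← Finset.Ico_add_one_right_eq_Icc, Finset.sum_Ico_eq_sum_range, Nat.add_sub_cancel]
  exact Finset.sum_congr rfl fun q _ => by rw [add_comm]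

theorem IsFSDM.recurrence_Icc {X : Type u} [NormedAddCommGroup X] [InnerProductSpace ℝ X]
    {T : X → X} {y : ℕ → X} (hy : IsFSDM T y) {j p : ℕ} {i t : ℕ → ℕ} (hj : 1 ≤ j)
    (hi : StrictAntiOn i (Set.Icc 1 p)) (hm : fsdmM j = ∑ q ∈ Finset.Icc 1 p, 2 ^ i q)
    (ht : ∀ r : ℕ, t r = ∑ q ∈ Finset.Icc 1 r, 2 ^ i q) :
    y j = y (j - 1) - (2 : ℝ) ^ padicValNat 2 j • fsdmG T y j
      + (1 / 2 : ℝ) • (y (fsdmM j) - y (j - 1))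
      + ∑ r ∈ Finset.Icc 1 p,
          (2 : ℝ) ^ ((padicValNat 2 j : ℤ) - (r : ℤ)) • fsdmG T y (t (p - r + 1)) := by
  have hdec : DecreasingBelow (fun q => i (q + 1)) p := fun a b hab hb =>
    hi ⟨by omega, by omega⟩ ⟨by omega, by omega⟩ (by omega)
  have ht' : ∀ r, t r = binarySum (fun q => i (q + 1)) r := fun r => by
    rw [ht, sum_Icc_one_eq_sum_range, binarySum]
  have hm' : binarySum (fun q => i (q + 1)) p = fsdmM j := by rw [← ht', ht, hm]
  refine (hy.recurrence hj hdec hm').trans ?_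
  congr 1
  rw [sum_Icc_one_eq_sum_range, ← Finset.sum_range_reflect]
  refine Finset.sum_congr rfl fun r hr => ?_
  rw [Finset.mem_range] at hr
  rw [ht', show p - (p - 1 - r) = r + 1 by omega, show p - (r + 1) + 1 = p - 1 - r + 1 by omega,
    zpow_sub₀ two_ne_zero, zpow_natCast, zpow_natCast]

theorem mainTheorem11 :
    -- the gluing that defines the matrices of FSDM is well defined at every level
    (∀ n : ℕ, ∃! c : Fin (fsdmSize n) → ℝ,
      HMat.IsGluingColumn (fsdmH n) (HMat.dual (fsdmH n)) c) ∧
    -- the fractal block structure of the matrices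
    (∀ n : ℕ, 1 ≤ n → ∀ k j : ℕ, 1 ≤ k → k ≤ 2 ^ n - 1 → 1 ≤ j → j ≤ 2 ^ n - 1 →
      HMat.entry (fsdmH n) k j =
        if k < 2 ^ (n - 1) then
          (if j < 2 ^ (n - 1) then HMat.entry (fsdmH (n - 1)) k j else 0)
        else if k = 2 ^ (n - 1) then
          (if j < 2 ^ (n - 1) then -(1 / 2 : ℝ) * fsdmA (n - 1) j
           else if j = 2 ^ (n - 1) then (2 : ℝ) ^ ((n : ℤ) - 2)
           else 0)
        else
          (if j < 2 ^ (n - 1) then 0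
           else if j = 2 ^ (n - 1) then -(1 / 2 : ℝ) * fsdmB (n - 1) (k - 2 ^ (n - 1))
           else HMat.entry (fsdmH (n - 1)) (k - 2 ^ (n - 1)) (j - 2 ^ (n - 1)))) ∧
    (∀ n i : ℕ, 1 ≤ n → 1 ≤ i → i ≤ 2 ^ n - 1 →
      HMat.entry (fsdmH n) i i = (2 : ℝ) ^ ((padicValNat 2 i : ℤ) - 1)) ∧
    -- FSDM runs from every starting point, and its iterates obey the recurrence
    (∀ (X : Type u) [NormedAddCommGroup X] [InnerProductSpace ℝ X] [CompleteSpace X]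
      (T : X → X),
      (∀ y₀ : X, ∃! y : ℕ → X, y 0 = y₀ ∧ IsFSDM T y) ∧
      ∀ y : ℕ → X, IsFSDM T y →
        (∀ (j p : ℕ) (i t : ℕ → ℕ), 1 ≤ j →
          StrictAntiOn i (Set.Icc 1 p) →
          fsdmM j = ∑ q ∈ Finset.Icc 1 p, 2 ^ i q →
          (∀ r : ℕ, t r = ∑ q ∈ Finset.Icc 1 r, 2 ^ i q) →
          y j = y (j - 1) - (2 : ℝ) ^ padicValNat 2 j • fsdmG T y j
            + (1 / 2 : ℝ) • (y (fsdmM j) - y (j - 1))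
            + ∑ r ∈ Finset.Icc 1 p,
                (2 : ℝ) ^ ((padicValNat 2 j : ℤ) - (r : ℤ)) • fsdmG T y (t (p - r + 1))) ∧
        (∀ n : ℕ,
          y (2 ^ n) = y (2 ^ n - 1) - (2 : ℝ) ^ n • fsdmG T y (2 ^ n)
            + (1 / 2 : ℝ) • (y 0 - y (2 ^ n - 1)))) ∧
    -- the iterates can be computed one after the other, with one evaluation of the operator
    -- per iteration, the first `N` iterations using at most `2 log₂ N + O(1)` vectors of memory
    (∃ (P : ℕ → List VecInstr) (C : ℕ),
      (∀ j : ℕ, 1 ≤ j → (P j).countP VecInstr.isQuery = 1) ∧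
      (∀ N : ℕ, 1 ≤ N → ∀ j : ℕ, 1 ≤ j → j ≤ N → ∀ I ∈ P j, ∀ r ∈ I.regs,
        r < 2 * Nat.log 2 N + C) ∧
      ∀ (X : Type u) [NormedAddCommGroup X] [InnerProductSpace ℝ X] [CompleteSpace X]
        (T : X → X) (y : ℕ → X), IsFSDM T y →
        ∀ R : ℕ → X, R 0 = y 0 → ∀ j : ℕ, runIterations T P R j 0 = y j) := by
  refine ⟨fun n => ⟨fractalColumn n, (isGluingColumn_fsdmH_iff n _).2 rfl,
      fun c hc => (isGluingColumn_fsdmH_iff n c).1 hc⟩, fun n hn k j _ _ _ _ => ?_,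
    fun n i _ hi hi' => ?_, fun X _ _ _ T => ⟨existsUnique_isFSDM T, fun y hy =>
      ⟨fun j p i t hj hi hm ht => hy.recurrence_Icc hj hi hm ht, fun n => ?_⟩⟩,
    fsdmProgram, 6, fun j _ => countP_isQuery_fsdmProgram j,
    fun N _ j hj hjN I hI r hr => regs_fsdmProgram_lt hj hjN hI hr,
    fun X _ _ _ T y hy R hR j => (registerInvariant_runIterations hy hR j).current⟩
  · obtain ⟨n, rfl⟩ : ∃ m, n = m + 1 := ⟨n - 1, by omega⟩
    have hdiag : (2 : ℝ) ^ (((n + 1 : ℕ) : ℤ) - 2) = 2 ^ n / 2 := by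
      rw [show ((n + 1 : ℕ) : ℤ) - 2 = (n : ℤ) - 1 by push_cast; ring,
        zpow_sub_one₀ two_ne_zero, zpow_natCast]
      rfl
    rw [hdiag]
    simp only [entry_fsdmH, Nat.add_sub_cancel]
    rw [fractalEntry]
  · rw [entry_fsdmH, fractalEntry_diag (by omega) (by omega), zpow_sub_one₀ two_ne_zero,
      zpow_natCast]
    rfl
  · have hm : fsdmM (2 ^ n) = 0 := by rw [fsdmM, padicValNat.prime_pow, Nat.sub_self]
    have h := hy.recurrence (j := 2 ^ n) (p := 0) (i := id) n.one_le_two_pow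
      (fun a b _ hb => by omega) hm.symm
    rwa [hm, padicValNat.prime_pow, Finset.range_zero, Finset.sum_empty, add_zero] at h
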